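/- Let $\Delta,\Gamma\ge 0$ be integers. For integers $n\ge\Delta$, $m\ge\Gamma$ let $\mathfrak s^{\Delta,\Gamma}_{n,m}$ be the complex Lie superalgebra generated, under the supercommutator $[A,B]_s=AB-(-1)^{\deg A\deg B}BA$, by the following $2\times2$ matrix differential operators in $x,y$ (diagonal matrices are even, antidiagonal matrices are odd): $$S^\epsilon=\operatorname{diag}(J^\epsilon_{n-\Delta},J^\epsilon_n),\quad T^\epsilon=\operatorname{diag}(K^\epsilon_m,K^\epsilon_{m-\Gamma})\quad(\epsilon=+,-,0),$$ $$J=\tfrac12\operatorname{diag}(n+\Delta,n),\qquad K=\tfrac12\operatorname{diag}(m,m+\Gamma),$$ $$Q^-_{\alpha\beta}=x^\alpha\,\bar q_\beta(y,m,\Gamma)\,\sigma^-,\qquad Q^+_{\alpha\beta}=\bar q_\alpha(x,n,\Delta)\,y^\beta\,\sigma^+\qquad(0\le\alpha\le\Delta,\ 0\le\beta\le\Gamma).$$ Here $J^+_n=x^2\partial_x-nx$, $J^-_n=\partial_x$, $J^0_n=x\partial_x-\frac n2$; the operators $K^\epsilon_m$ are given by the same formulas with $y,m$ in place of $x,n$;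 $\sigma^+=(\sigma^-)^t=\begin{pmatrix}0&1\\0&0\end{pmatrix}$; and $\bar q_\alpha(x,n,\Delta)=\prod_{k=1}^{\Delta-\alpha}(x\partial_x-n+\Delta-k)\,\partial_x^\alpha$, an empty product being $1$. Let $\mathfrak s^{\Delta,\Gamma}$ be the abstract Lie superalgebra realized by these generators, that is, the complex Lie superalgebra generated by the same operators with $n$ and $m$ regarded as formal parameters (indeterminates). (i) $\mathfrak s^{\Delta,\Gamma}$ is finite-dimensional if and only if $\Delta+\Gamma\le1$. Likewise, for all integers $n\ge\Delta$, $m\ge\Gamma$, the realization $\mathfrak s^{\Delta,\Gamma}_{n,m}$ is finite-dimensional if and only if $\Delta+\Gamma\le1$. (ii) Omit the central generator $K$ when $(\Delta,\Gamma)=(1,0)$, and the central generator $J$ when $(\Delta,\Gamma)=(0,1)$. Then, as Lie superalgebras, $$\mathfrak s^{1,0}\simeq\mathfrak s^{0,1}\simeq\mathfrak{spl}(2,1)\oplus\mathfrak{sl}_2,$$ where $\mathfrak{spl}(2,1)$ is the Lie superalgebra of complex $3\times3$ matrices of block format $2+1$ with vanishing supertrace; and the same holds for all realizations $\mathfrak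 s^{1,0}_{n,m}$ ($n\ge1$, $m\ge0$) and $\mathfrak s^{0,1}_{n,m}$ ($n\ge0$, $m\ge1$). (iii) For $\Delta=\Gamma=0$, replace $J$ and $K$ by $\operatorname{diag}(1,-1)$ and regard $\mathfrak s^{0,0}$ as a Lie algebra under the ordinary commutator. Then $\mathfrak s^{0,0}\simeq\mathfrak{sl}_2\oplus\mathfrak{sl}_2\oplus\mathfrak{sl}_2$, and the same holds for all realizations $\mathfrak s^{0,0}_{n,m}$ ($n,m\ge0$). -/

import Mathlib

noncomputable section

/-! ## Lie superalgebras over `ℂ` -/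

/-- The sign `(-1)^(i j)` for `i, j ∈ ℤ/2`. -/
def superSign (i j : ZMod 2) : ℂ := if i = 1 ∧ j = 1 then -1 else 1

/-- A complex Lie superalgebra: a `ℤ/2`-graded vector space `L = L₀ ⊕ L₁` (with `Lᵢ = homog i`)
and a bilinear bracket of degree zero, graded skew-symmetric and satisfying the graded Jacobi
identity. -/
class LieSuperalgebra (L : Type*) [AddCommGroup L] [Module ℂ L] where
  sbr : L →ₗ[ℂ] L →ₗ[ℂ] L
  homog : ZMod 2 → Submodule ℂ L
  isCompl : IsCompl (homog 0) (homog 1)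
  sbr_mem : ∀ {i j : ZMod 2} {a b : L}, a ∈ homog i → b ∈ homog j → sbr a b ∈ homog (i + j)
  skew : ∀ {i j : ZMod 2} {a b : L}, a ∈ homog i → b ∈ homog j →
    sbr a b = -(superSign i j • sbr b a)
  jacobi : ∀ {i j k : ZMod 2} {a b c : L}, a ∈ homog i → b ∈ homog j → c ∈ homog k →
    sbr a (sbr b c) = sbr (sbr a b) c + superSign i j • sbr b (sbr a c)

open LieSuperalgebra

/-- Isomorphism of Lie superalgebras: a linear bijection, compatible with brackets, that
preserves parity. -/
def SuperIso (L M : Type*) [AddCommGroup L] [Module ℂ L] [LieSuperalgebra L]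
    [AddCommGroup M] [Module ℂ M] [LieSuperalgebra M] : Prop :=
  ∃ e : L ≃ₗ[ℂ] M, (∀ a b : L, e (sbr a b) = sbr (e a) (e b)) ∧
    ∀ (i : ZMod 2) (a : L), e a ∈ (homog i : Submodule ℂ M) ↔ a ∈ (homog i : Submodule ℂ L)

/-- A graded subalgebra of a Lie superalgebra. -/
structure LieSubsuperalgebra (L : Type*) [AddCommGroup L] [Module ℂ L] [LieSuperalgebra L] where
  carrier : Submodule ℂ L
  sbr_closed : ∀ {a b : L}, a ∈ carrier → b ∈ carrier → sbr a b ∈ carrier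
  graded : ∀ {a b : L}, a ∈ (homog 0 : Submodule ℂ L) → b ∈ (homog 1 : Submodule ℂ L) →
    a + b ∈ carrier → a ∈ carrier ∧ b ∈ carrier

/-- A graded subalgebra is a Lie superalgebra. -/
instance LieSubsuperalgebra.instLieSuperalgebra {L : Type*} [AddCommGroup L] [Module ℂ L]
    [LieSuperalgebra L] (s : LieSubsuperalgebra L) : LieSuperalgebra s.carrier where
  sbr := LinearMap.mk₂ ℂ (fun a b => ⟨sbr (a : L) (b : L), s.sbr_closed a.2 b.2⟩)
    (by intros; ext; simp) (by intros; ext; simp) (by intros; ext; simp) (by intros; ext; simp)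
  homog i := (homog i).comap s.carrier.subtype
  isCompl := by
    have h : IsCompl (homog 0 : Submodule ℂ L) (homog 1) := LieSuperalgebra.isCompl
    constructor
    · rw [Submodule.disjoint_def]
      intro x h0 h1
      ext
      exact (Submodule.disjoint_def.1 h.disjoint) _ h0 h1
    · rw [codisjoint_iff, eq_top_iff]
      rintro ⟨x, hx⟩ -
      have hx' : x ∈ (homog 0 : Submodule ℂ L) ⊔ homog 1 := by
        rw [codisjoint_iff.1 h.codisjoint]; trivial
      obtain ⟨a, ha, b, hb, rfl⟩ := Submodule.mem_sup.1 hx'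
      obtain ⟨h0, h1⟩ := s.graded ha hb hx
      exact Submodule.mem_sup.2 ⟨⟨a, h0⟩, ha, ⟨b, h1⟩, hb, rfl⟩
  sbr_mem ha hb := LieSuperalgebra.sbr_mem (L := L) ha hb
  skew ha hb := Subtype.ext (LieSuperalgebra.skew (L := L) ha hb)
  jacobi ha hb hc := Subtype.ext (LieSuperalgebra.jacobi (L := L) ha hb hc)

/-- The graded subalgebra generated by a set: the smallest one that contains it. -/
def superSpan {L : Type*} [AddCommGroup L] [Module ℂ L] [LieSuperalgebra L] (S : Set L) :
    LieSubsuperalgebra L where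
  carrier := sInf {p | ∃ s : LieSubsuperalgebra L, s.carrier = p ∧ S ⊆ s.carrier}
  sbr_closed := by
    intro a b ha hb
    rw [Submodule.mem_sInf] at *
    rintro _ ⟨s, rfl, hs⟩
    exact s.sbr_closed (ha _ ⟨s, rfl, hs⟩) (hb _ ⟨s, rfl, hs⟩)
  graded := by
    intro a b ha hb hab
    rw [Submodule.mem_sInf] at hab
    constructor
    · rw [Submodule.mem_sInf]
      rintro _ ⟨s, rfl, hs⟩
      exact (s.graded ha hb (hab _ ⟨s, rfl, hs⟩)).1
    · rw [Submodule.mem_sInf]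
      rintro _ ⟨s, rfl, hs⟩
      exact (s.graded ha hb (hab _ ⟨s, rfl, hs⟩)).2

/-- The direct sum of two Lie superalgebras. -/
instance Prod.instLieSuperalgebra {L M : Type*} [AddCommGroup L] [Module ℂ L] [LieSuperalgebra L]
    [AddCommGroup M] [Module ℂ M] [LieSuperalgebra M] : LieSuperalgebra (L × M) where
  sbr := LinearMap.mk₂ ℂ (fun a b => (sbr a.1 b.1, sbr a.2 b.2))
    (by intros; ext <;> simp) (by intros; ext <;> simp) (by intros; ext <;> simp)
    (by intros; ext <;> simp)
  homog i := (homog i).prod (homog i)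
  isCompl := by
    have h : IsCompl (homog 0 : Submodule ℂ L) (homog 1) := LieSuperalgebra.isCompl
    have h' : IsCompl (homog 0 : Submodule ℂ M) (homog 1) := LieSuperalgebra.isCompl
    constructor
    · rw [disjoint_iff, Submodule.prod_inf_prod, h.inf_eq_bot, h'.inf_eq_bot, Submodule.prod_bot]
    · rw [codisjoint_iff, Submodule.prod_sup_prod, h.sup_eq_top, h'.sup_eq_top, Submodule.prod_top]
  sbr_mem ha hb := ⟨LieSuperalgebra.sbr_mem ha.1 hb.1, LieSuperalgebra.sbr_mem ha.2 hb.2⟩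
  skew ha hb := Prod.ext (LieSuperalgebra.skew ha.1 hb.1) (LieSuperalgebra.skew ha.2 hb.2)
  jacobi ha hb hc := Prod.ext (LieSuperalgebra.jacobi ha.1 hb.1 hc.1)
    (LieSuperalgebra.jacobi ha.2 hb.2 hc.2)

/-- A Lie algebra, seen as a purely even Lie superalgebra. -/
@[reducible] def LieSuperalgebra.ofLieAlgebra (L : Type*) [LieRing L] [LieAlgebra ℂ L] :
    LieSuperalgebra L where
  sbr := LinearMap.mk₂ ℂ (fun a b => ⁅a, b⁆)
    (by intros; simp) (by intros; simp) (by intros; simp) (by intros; simp)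
  homog i := if i = 0 then ⊤ else ⊥
  isCompl := by simpa using isCompl_top_bot
  sbr_mem := by
    intro i j a b ha hb
    by_cases hi : i = 0 <;> by_cases hj : j = 0 <;> simp_all
  skew := by
    intro i j a b ha hb
    by_cases hi : i = 0 <;> by_cases hj : j = 0 <;> simp_all [superSign]
  jacobi := by
    intro i j k a b c ha hb hc
    by_cases hi : i = 0 <;> by_cases hj : j = 0 <;> simp_all [superSign]

/-! ## Matrices with a parity -/

/-- Square matrices over an associative algebra `E` whose rows and columns carry a parity `p`;
the entry `(i, j)` has degree `p i + p j`. -/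
def SuperMatrix {ι : Type} (_p : ι → ZMod 2) (E : Type*) : Type _ := Matrix ι ι E

instance SuperMatrix.instAddCommGroup {ι : Type} (p : ι → ZMod 2) (E : Type*) [Ring E] :
    AddCommGroup (SuperMatrix p E) := inferInstanceAs (AddCommGroup (Matrix ι ι E))

instance SuperMatrix.instModule {ι : Type} (p : ι → ZMod 2) (E : Type*) [Ring E] [Algebra ℂ E] :
    Module ℂ (SuperMatrix p E) := inferInstanceAs (Module ℂ (Matrix ι ι E))

/-- The homogeneous component of degree `k` of a matrix. -/
def superComponent {ι : Type} {E : Type*} [Ring E] (p : ι → ZMod 2) (k : ZMod 2)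
    (a : Matrix ι ι E) : Matrix ι ι E :=
  Matrix.of fun i j => if p i + p j = k then a i j else 0

/-- The matrices that are homogeneous of degree `k`. -/
def superHomogeneous {ι : Type} (p : ι → ZMod 2) (E : Type*) [Ring E] [Algebra ℂ E]
    (k : ZMod 2) : Submodule ℂ (Matrix ι ι E) where
  carrier := {a | ∀ i j, p i + p j ≠ k → a i j = 0}
  add_mem' ha hb i j h := by simp [ha i j h, hb i j h]
  zero_mem' i j _ := rfl
  smul_mem' c a ha i j h := by simp [ha i j h]

/-- The supercommutator: the bilinear extension of `(a, b) ↦ a b - (-1)^(deg a deg b) b a`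
from homogeneous matrices to all matrices. -/
def superCommutator {ι : Type} [Fintype ι] {E : Type*} [Ring E] [Algebra ℂ E] (p : ι → ZMod 2)
    (a b : Matrix ι ι E) : Matrix ι ι E :=
  ∑ k : ZMod 2, ∑ l : ZMod 2, (superComponent p k a * superComponent p l b -
    superSign k l • (superComponent p l b * superComponent p k a))

lemma superComponent_add {ι : Type} {E : Type*} [Ring E] (p : ι → ZMod 2) (k : ZMod 2)
    (a b : Matrix ι ι E) :
    superComponent p k (a + b) = superComponent p k a + superComponent p k b := by
  ext i j
  by_cases h : p i + p j = k <;> simp [superComponent, h]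

lemma superComponent_smul {ι : Type} {E : Type*} [Ring E] [Algebra ℂ E] (p : ι → ZMod 2)
    (k : ZMod 2) (c : ℂ) (a : Matrix ι ι E) :
    superComponent p k (c • a) = c • superComponent p k a := by
  ext i j
  by_cases h : p i + p j = k <;> simp [superComponent, h]

lemma superComponent_mem {ι : Type} {E : Type*} [Ring E] [Algebra ℂ E] (p : ι → ZMod 2)
    (k : ZMod 2) (a : Matrix ι ι E) : superComponent p k a ∈ superHomogeneous p E k := by
  intro i j h
  simp [superComponent, h]

lemma superComponent_of_mem {ι : Type} {E : Type*} [Ring E] [Algebra ℂ E] {p : ι → ZMod 2}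
    {k : ZMod 2} {a : Matrix ι ι E} (ha : a ∈ superHomogeneous p E k) (l : ZMod 2) :
    superComponent p l a = if k = l then a else 0 := by
  ext i j
  by_cases h : p i + p j = k
  · by_cases hl : k = l <;> simp [superComponent, h, hl]
  · have := ha i j h
    by_cases hl : k = l <;> simp [superComponent, hl, this]

lemma superComponent_sum {ι : Type} {E : Type*} [Ring E] (p : ι → ZMod 2)
    (a : Matrix ι ι E) : superComponent p 0 a + superComponent p 1 a = a := by
  have hz : ∀ z : ZMod 2, z = 0 ∨ z = 1 := by decide
  ext i j
  rcases hz (p i + p j) with h | h <;> simp [superComponent, h]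

lemma superCommutator_of_mem {ι : Type} [Fintype ι] {E : Type*} [Ring E] [Algebra ℂ E]
    {p : ι → ZMod 2} {k l : ZMod 2} {a b : Matrix ι ι E} (ha : a ∈ superHomogeneous p E k)
    (hb : b ∈ superHomogeneous p E l) :
    superCommutator p a b = a * b - superSign k l • (b * a) := by
  unfold superCommutator
  simp only [superComponent_of_mem ha, superComponent_of_mem hb]
  rw [Finset.sum_eq_single k, Finset.sum_eq_single l]
  · simp
  · intro j _ hj
    simp [hj.symm]
  · simp
  · intro j _ hj
    simp [hj.symm]
  · simp

lemma superHomogeneous_mul {ι : Type} [Fintype ι] {E : Type*} [Ring E] [Algebra ℂ E]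
    {p : ι → ZMod 2} {k l : ZMod 2} {a b : Matrix ι ι E} (ha : a ∈ superHomogeneous p E k)
    (hb : b ∈ superHomogeneous p E l) : a * b ∈ superHomogeneous p E (k + l) := by
  intro i j h
  rw [Matrix.mul_apply]
  refine Finset.sum_eq_zero fun r _ => ?_
  by_cases h1 : p i + p r = k
  · by_cases h2 : p r + p j = l
    · exfalso
      apply h
      rw [← h1, ← h2, add_assoc, ← add_assoc (p r), CharTwo.add_self_eq_zero, zero_add]
    · rw [hb _ _ h2, mul_zero]
  · rw [ha _ _ h1, zero_mul]

lemma superCommutator_mem {ι : Type} [Fintype ι] {E : Type*} [Ring E] [Algebra ℂ E]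
    {p : ι → ZMod 2} {k l : ZMod 2} {a b : Matrix ι ι E} (ha : a ∈ superHomogeneous p E k)
    (hb : b ∈ superHomogeneous p E l) :
    superCommutator p a b ∈ superHomogeneous p E (k + l) := by
  rw [superCommutator_of_mem ha hb]
  refine Submodule.sub_mem _ (superHomogeneous_mul ha hb) (Submodule.smul_mem _ _ ?_)
  rw [add_comm]
  exact superHomogeneous_mul hb ha

lemma superHomogeneous_isCompl {ι : Type} (p : ι → ZMod 2) (E : Type*) [Ring E] [Algebra ℂ E] :
    IsCompl (superHomogeneous p E 0) (superHomogeneous p E 1) := by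
  constructor
  · refine Submodule.disjoint_def.2 fun a h0 h1 => ?_
    have h := superComponent_of_mem h0 0
    rw [superComponent_of_mem h1 0] at h
    simpa using h.symm
  · refine codisjoint_iff.2 (eq_top_iff.2 fun a _ => ?_)
    exact Submodule.mem_sup.2 ⟨superComponent p 0 a, superComponent_mem p 0 a,
      superComponent p 1 a, superComponent_mem p 1 a, superComponent_sum p a⟩

lemma superCommutator_skew {ι : Type} [Fintype ι] {E : Type*} [Ring E] [Algebra ℂ E]
    {p : ι → ZMod 2} {i j : ZMod 2} {a b : Matrix ι ι E} (ha : a ∈ superHomogeneous p E i)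
    (hb : b ∈ superHomogeneous p E j) :
    superCommutator p a b = -(superSign i j • superCommutator p b a) := by
  rw [superCommutator_of_mem ha hb, superCommutator_of_mem hb ha]
  by_cases hi : i = 1 <;> by_cases hj : j = 1 <;> simp [superSign, hi, hj, add_comm]

lemma superCommutator_jacobi {ι : Type} [Fintype ι] {E : Type*} [Ring E] [Algebra ℂ E]
    {p : ι → ZMod 2} {i j k : ZMod 2} {a b c : Matrix ι ι E} (ha : a ∈ superHomogeneous p E i)
    (hb : b ∈ superHomogeneous p E j) (hc : c ∈ superHomogeneous p E k) :
    superCommutator p a (superCommutator p b c) = superCommutator p (superCommutator p a b) c +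
      superSign i j • superCommutator p b (superCommutator p a c) := by
  rw [superCommutator_of_mem ha (superCommutator_mem hb hc), superCommutator_of_mem hb hc,
    superCommutator_of_mem (superCommutator_mem ha hb) hc, superCommutator_of_mem ha hb,
    superCommutator_of_mem hb (superCommutator_mem ha hc), superCommutator_of_mem ha hc]
  have hz : ∀ z : ZMod 2, z = 0 ∨ z = 1 := by decide
  have h11 : (1 : ZMod 2) + 1 = 0 := by decide
  rcases hz i with rfl | rfl <;> rcases hz j with rfl | rfl <;> rcases hz k with rfl | rfl <;>
    simp [superSign, h11, mul_add, add_mul, mul_sub, sub_mul, mul_assoc] <;> abel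

/-- The supercommutator as a bilinear map. -/
def superCommutatorBilin {ι : Type} [Fintype ι] {E : Type*} [Ring E] [Algebra ℂ E]
    (p : ι → ZMod 2) : Matrix ι ι E →ₗ[ℂ] Matrix ι ι E →ₗ[ℂ] Matrix ι ι E :=
  LinearMap.mk₂ ℂ (superCommutator p)
    (by
      intro a a' b
      simp only [superCommutator, superComponent_add, add_mul, mul_add, smul_add,
        ← Finset.sum_add_distrib]
      exact Finset.sum_congr rfl fun _ _ => Finset.sum_congr rfl fun _ _ => by abel)
    (by
      intro c a b
      simp only [superCommutator, superComponent_smul, smul_mul_assoc, mul_smul_comm,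
        Finset.smul_sum, smul_sub]
      exact Finset.sum_congr rfl fun _ _ => Finset.sum_congr rfl fun _ _ => by
        rw [smul_comm])
    (by
      intro a b b'
      simp only [superCommutator, superComponent_add, add_mul, mul_add, smul_add,
        ← Finset.sum_add_distrib]
      exact Finset.sum_congr rfl fun _ _ => Finset.sum_congr rfl fun _ _ => by abel)
    (by
      intro c a b
      simp only [superCommutator, superComponent_smul, smul_mul_assoc, mul_smul_comm,
        Finset.smul_sum, smul_sub]
      exact Finset.sum_congr rfl fun _ _ => Finset.sum_congr rfl fun _ _ => by
        rw [smul_comm])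

/-- The Lie superalgebra of all matrices with parity `p`. -/
instance SuperMatrix.instLieSuperalgebra {ι : Type} [Fintype ι] (p : ι → ZMod 2) (E : Type*)
    [Ring E] [Algebra ℂ E] : LieSuperalgebra (SuperMatrix p E) where
  sbr := superCommutatorBilin (E := E) p
  homog k := superHomogeneous p E k
  isCompl := superHomogeneous_isCompl p E
  sbr_mem ha hb := superCommutator_mem ha hb
  skew ha hb := superCommutator_skew ha hb
  jacobi ha hb hc := superCommutator_jacobi ha hb hc

/-! ## The classical Lie superalgebras that occur -/

/-- `sl₂`, seen as a Lie superalgebra. -/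
abbrev SL2 : Type := LieAlgebra.SpecialLinear.sl (Fin 2) ℂ

instance SL2.instLieSuperalgebra : LieSuperalgebra SL2 := LieSuperalgebra.ofLieAlgebra SL2

/-- The parity of the rows and columns of a matrix of block format `2 + 1`. -/
def parity21 : Fin 3 → ZMod 2 := ![0, 0, 1]

/-- `spl(2,1)`: the graded subalgebra of `gl(2,1)` of all matrices of supertrace zero. -/
def spl21 : LieSubsuperalgebra (SuperMatrix parity21 ℂ) where
  carrier :=
    { carrier := {a : Matrix (Fin 3) (Fin 3) ℂ | a 0 0 + a 1 1 - a 2 2 = 0}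
      add_mem' := by
        intro a b ha hb
        change (a 0 0 + b 0 0) + (a 1 1 + b 1 1) - (a 2 2 + b 2 2) = 0
        have ha' : a 0 0 + a 1 1 - a 2 2 = 0 := ha
        have hb' : b 0 0 + b 1 1 - b 2 2 = 0 := hb
        linear_combination ha' + hb'
      zero_mem' := by
        change (0 : ℂ) + 0 - 0 = 0
        simp
      smul_mem' := by
        intro c a ha
        change c * a 0 0 + c * a 1 1 - c * a 2 2 = 0
        have ha' : a 0 0 + a 1 1 - a 2 2 = 0 := ha
        linear_combination c * ha' }
  sbr_closed := by
    intro a b _ _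
    have hs : (Finset.univ : Finset (ZMod 2)) = {0, 1} := by decide
    change superCommutator parity21 (a : Matrix (Fin 3) (Fin 3) ℂ) b 0 0 +
      superCommutator parity21 (a : Matrix (Fin 3) (Fin 3) ℂ) b 1 1 -
      superCommutator parity21 (a : Matrix (Fin 3) (Fin 3) ℂ) b 2 2 = 0
    simp [superCommutator, superComponent, superSign, hs, parity21, Matrix.mul_apply,
      Fin.sum_univ_three]
    ring
  graded := by
    intro a b ha hb hab
    have h : (a 0 0 + b 0 0) + (a 1 1 + b 1 1) - (a 2 2 + b 2 2) = 0 := hab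
    have hd : ∀ i, b i i = 0 := fun i => hb i i (by rw [CharTwo.add_self_eq_zero]; decide)
    constructor
    · change a 0 0 + a 1 1 - a 2 2 = 0
      simpa [hd] using h
    · change b 0 0 + b 1 1 - b 2 2 = 0
      simp [hd]

/-! ## The matrix differential operators -/

/-- The operators on `A[x, y]`. For `A = ℂ`, differential operators in two variables with polynomial
coefficients are identified with their (faithful) action on `ℂ[x, y]`. A larger algebra `A` serves
to carry the parameters `n`, `m` as indeterminates. -/
abbrev PolyOp (A : Type) [CommRing A] : Type := Module.End A (MvPolynomial (Fin 2) A)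

/-- Multiplication by the variable `x` (`i = 0`) or `y` (`i = 1`). -/
def opX (A : Type) [CommRing A] (i : Fin 2) : PolyOp A :=
  LinearMap.mulLeft A (MvPolynomial.X i)

/-- The partial derivative in `x` (`i = 0`) or `y` (`i = 1`). -/
def opD (A : Type) [CommRing A] (i : Fin 2) : PolyOp A :=
  (MvPolynomial.pderiv i : Derivation A (MvPolynomial (Fin 2) A) (MvPolynomial (Fin 2) A))

/-- Multiplication by a constant. -/
def opC {A : Type} [CommRing A] (c : A) : PolyOp A := algebraMap A (PolyOp A) c

/-- One half of a constant. -/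
def half {A : Type} [CommRing A] [Algebra ℂ A] (c : A) : A := (1 / 2 : ℂ) • c

/-- `x² ∂ₓ - ν x`. -/
def opPlus {A : Type} [CommRing A] (i : Fin 2) (ν : A) : PolyOp A :=
  opX A i ^ 2 * opD A i - opC ν * opX A i

/-- `x ∂ₓ - ν / 2`. -/
def opZero {A : Type} [CommRing A] [Algebra ℂ A] (i : Fin 2) (ν : A) : PolyOp A :=
  opX A i * opD A i - opC (half ν)

/-- `∏_{k = 1}^{Δ - α} (x ∂ₓ - ν + Δ - k) ∂ₓ^α`. -/
def qbar {A : Type} [CommRing A] (i : Fin 2) (ν : A) (Δ α : ℕ) : PolyOp A :=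
  ((List.range (Δ - α)).map fun k =>
    opX A i * opD A i - opC ν + opC (Δ : A) - opC ((k + 1 : ℕ) : A)).prod * opD A i ^ α

/-- The parity of the rows and columns of a `2 × 2` matrix: diagonal matrices are even,
antidiagonal matrices are odd. -/
def parity11 : Fin 2 → ZMod 2 := ![0, 1]

/-- The Lie superalgebra of `2 × 2` matrix operators. -/
abbrev MatOp (A : Type) [CommRing A] : Type := SuperMatrix parity11 (PolyOp A)

/-- `diag(a, b)`. -/
def opDiag {A : Type} [CommRing A] (a b : PolyOp A) : Matrix (Fin 2) (Fin 2) (PolyOp A) :=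
  !![a, 0; 0, b]

/-- `a σ⁺`. -/
def opUp {A : Type} [CommRing A] (a : PolyOp A) : Matrix (Fin 2) (Fin 2) (PolyOp A) :=
  !![0, a; 0, 0]

/-- `a σ⁻`. -/
def opDown {A : Type} [CommRing A] (a : PolyOp A) : Matrix (Fin 2) (Fin 2) (PolyOp A) :=
  !![0, 0; a, 0]

/-- The six operators `S⁺, S⁻, S⁰, T⁺, T⁻, T⁰`, for parameters `n = ν`, `m = μ`. -/
def gensST {A : Type} [CommRing A] [Algebra ℂ A] (Δ Γ : ℕ) (ν μ : A) :
    Set (Matrix (Fin 2) (Fin 2) (PolyOp A)) :=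
  {opDiag (opPlus 0 (ν - (Δ : A))) (opPlus 0 ν), opDiag (opD A 0) (opD A 0),
    opDiag (opZero 0 (ν - (Δ : A))) (opZero 0 ν),
    opDiag (opPlus 1 μ) (opPlus 1 (μ - (Γ : A))), opDiag (opD A 1) (opD A 1),
    opDiag (opZero 1 μ) (opZero 1 (μ - (Γ : A)))}

/-- `J = ½ diag(n + Δ, n)`. -/
def genJ {A : Type} [CommRing A] [Algebra ℂ A] (Δ : ℕ) (ν : A) :
    Matrix (Fin 2) (Fin 2) (PolyOp A) :=
  opDiag (opC (half (ν + (Δ : A)))) (opC (half ν))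

/-- `K = ½ diag(m, m + Γ)`. -/
def genK {A : Type} [CommRing A] [Algebra ℂ A] (Γ : ℕ) (μ : A) :
    Matrix (Fin 2) (Fin 2) (PolyOp A) :=
  opDiag (opC (half μ)) (opC (half (μ + (Γ : A))))

/-- The operators `Q⁻_{αβ} = x^α q̄_β(y, m, Γ) σ⁻` and `Q⁺_{αβ} = q̄_α(x, n, Δ) y^β σ⁺`, for
`0 ≤ α ≤ Δ` and `0 ≤ β ≤ Γ`. -/
def gensQ {A : Type} [CommRing A] (Δ Γ : ℕ) (ν μ : A) :
    Set (Matrix (Fin 2) (Fin 2) (PolyOp A)) :=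
  {Q | ∃ α β : ℕ, α ≤ Δ ∧ β ≤ Γ ∧
    (Q = opDown (opX A 0 ^ α * qbar 1 μ Γ β) ∨ Q = opUp (qbar 0 ν Δ α * opX A 1 ^ β))}

/-- The Lie superalgebra generated by all the operators `S`, `T`, `J`, `K`, `Q`. -/
def superS {A : Type} [CommRing A] [Algebra ℂ A] (Δ Γ : ℕ) (ν μ : A) :
    LieSubsuperalgebra (MatOp A) :=
  superSpan (L := MatOp A) (gensST Δ Γ ν μ ∪ {genJ Δ ν, genK Γ μ} ∪ gensQ Δ Γ ν μ)

/-- The case `Δ = 1`, `Γ = 0`, where `K` is a multiple of the identity, without `K`. -/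
def superS10 {A : Type} [CommRing A] [Algebra ℂ A] (ν μ : A) : LieSubsuperalgebra (MatOp A) :=
  superSpan (L := MatOp A) (gensST 1 0 ν μ ∪ {genJ 1 ν} ∪ gensQ 1 0 ν μ)

/-- The case `Δ = 0`, `Γ = 1`, where `J` is a multiple of the identity, without `J`. -/
def superS01 {A : Type} [CommRing A] [Algebra ℂ A] (ν μ : A) : LieSubsuperalgebra (MatOp A) :=
  superSpan (L := MatOp A) (gensST 0 1 ν μ ∪ {genK 1 μ} ∪ gensQ 0 1 ν μ)

section

attribute [local instance] LieRing.ofAssociativeRing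

/-- The case `Δ = Γ = 0`, regarded as a Lie algebra (under the ordinary commutator), with `J` and
`K` replaced by `σ₃ = diag(1, -1)`. -/
def lieS00 {A : Type} [CommRing A] [Algebra ℂ A] (ν μ : A) :
    LieSubalgebra ℂ (Matrix (Fin 2) (Fin 2) (PolyOp A)) :=
  LieSubalgebra.lieSpan ℂ (Matrix (Fin 2) (Fin 2) (PolyOp A))
    (gensST 0 0 ν μ ∪ {opDiag 1 (-1)} ∪ gensQ 0 0 ν μ)

end

/-- The parameters `n` and `m` as indeterminates. -/
abbrev ParamRing : Type := MvPolynomial (Fin 2) ℂ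

/-- The indeterminate `n`. -/
def formalN : ParamRing := MvPolynomial.X 0

/-- The indeterminate `m`. -/
def formalM : ParamRing := MvPolynomial.X 1

end

/-!
In the homogeneous coordinate `x = z₁ / z₀`, a homogeneous function of degree `ν` in `z₀`, `z₁`
is a function of `x`; multiplication by `z₀`, `z₁` becomes multiplication by `1`, `x`, and
`∂/∂z₀`, `∂/∂z₁` become `ν - x ∂ₓ`, `∂ₓ`. Hence `gl₂` acts on functions of degree `ν` by `∑ a_rs
z_r ∂/∂z_s`, and `J⁺`, `J⁻`, `J⁰` generate the action of `sl₂`. With one more odd coordinate `θ`,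
the superalgebra `gl(2|1)` acts in the same way on the functions `f + θ g`, where `f` has degree
`ν` and `g` has degree `ν - 1`. For `Δ = 1`, `Γ = 0` the operators `S`, `J`, `Q` span the image
of `spl(2,1)` under this action, while the operators `T` span a commuting copy of `sl₂`. The case
`Δ = 0`, `Γ = 1` is the same with `x` and `y` exchanged, and for `Δ = Γ = 0` the `Q` become
constant matrices.

If `Δ + Γ ≥ 2`, then suitable `Q⁻` and `Q⁺` have the supercommutator `diag(∂ₓ^Δ ∂_y^Γ, ∂ₓ^Δ
∂_y^Γ)`, and others, with an extra factor `x` or `y`, have a supercommutator with entry `x ∂ₓ^Δ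
∂_y^Γ` or `y ∂ₓ^Δ ∂_y^Γ`. Commuting with the latter repeatedly raises the order of
constant-coefficient operators without bound.
-/

noncomputable section

open LieSuperalgebra

section LieSuperalgebra

variable {L M N : Type*} [AddCommGroup L] [Module ℂ L] [LieSuperalgebra L]
  [AddCommGroup M] [Module ℂ M] [LieSuperalgebra M]
  [AddCommGroup N] [Module ℂ N] [LieSuperalgebra N]

lemma exists_homog_add (a : L) :
    ∃ a₀ ∈ (homog 0 : Submodule ℂ L), ∃ a₁ ∈ (homog 1 : Submodule ℂ L), a₀ + a₁ = a := by
  have hcompl : IsCompl (homog 0 : Submodule ℂ L) (homog 1) := LieSuperalgebra.isCompl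
  exact Submodule.mem_sup.1 (hcompl.sup_eq_top ▸ Submodule.mem_top)

lemma eq_of_homog_add_eq {a b a' b' : L} (ha : a ∈ (homog 0 : Submodule ℂ L))
    (hb : b ∈ (homog 1 : Submodule ℂ L)) (ha' : a' ∈ (homog 0 : Submodule ℂ L))
    (hb' : b' ∈ (homog 1 : Submodule ℂ L)) (h : a + b = a' + b') : a = a' ∧ b = b' := by
  have hcompl : IsCompl (homog 0 : Submodule ℂ L) (homog 1) := LieSuperalgebra.isCompl
  have hsub : a - a' = b' - b := by rw [sub_eq_sub_iff_add_eq_add, h, add_comm]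
  have hzero : a - a' = 0 := Submodule.disjoint_def.1 hcompl.disjoint _
    (Submodule.sub_mem _ ha ha') (hsub ▸ Submodule.sub_mem _ hb' hb)
  exact ⟨sub_eq_zero.1 hzero, (sub_eq_zero.1 (hsub ▸ hzero)).symm⟩

lemma sbr_eq_neg_of_even {a : L} (ha : a ∈ (homog 0 : Submodule ℂ L)) (b : L) :
    sbr b a = -sbr a b := by
  obtain ⟨b₀, h₀, b₁, h₁, rfl⟩ := exists_homog_add b
  rw [map_add, LinearMap.add_apply, map_add, skew h₀ ha, skew h₁ ha]
  simp [superSign, add_comm]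

/-- A homomorphism of Lie superalgebras: a linear map that respects brackets and parity. -/
structure IsSuperHom (φ : L →ₗ[ℂ] M) : Prop where
  map_sbr : ∀ a b, φ (sbr a b) = sbr (φ a) (φ b)
  map_homog : ∀ {i : ZMod 2} {a : L}, a ∈ (homog i : Submodule ℂ L) →
    φ a ∈ (homog i : Submodule ℂ M)

namespace IsSuperHom

lemma comp_subtype {φ : L →ₗ[ℂ] M} (hφ : IsSuperHom φ) (s : LieSubsuperalgebra L) :
    IsSuperHom (φ ∘ₗ s.carrier.subtype) where
  map_sbr a b := hφ.map_sbr a b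
  map_homog ha := hφ.map_homog ha

lemma coprod {φ : L →ₗ[ℂ] N} {ψ : M →ₗ[ℂ] N} (hφ : IsSuperHom φ) (hψ : IsSuperHom ψ)
    (heven : ∀ b, ψ b ∈ (homog 0 : Submodule ℂ N)) (hcomm : ∀ a b, sbr (ψ b) (φ a) = 0) :
    IsSuperHom (φ.coprod ψ) where
  map_sbr := by
    rintro ⟨a, b⟩ ⟨a', b'⟩
    change φ (sbr a a') + ψ (sbr b b') = sbr (φ a + ψ b) (φ a' + ψ b')
    simp [hφ.map_sbr, hψ.map_sbr, hcomm, sbr_eq_neg_of_even (heven b')]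
  map_homog := by
    rintro i ⟨a, b⟩ ⟨ha, hb⟩
    exact Submodule.add_mem _ (hφ.map_homog ha) (hψ.map_homog hb)

/-- The image of a homomorphism, as a graded subalgebra. -/
def range {φ : L →ₗ[ℂ] M} (hφ : IsSuperHom φ) : LieSubsuperalgebra M where
  carrier := LinearMap.range φ
  sbr_closed := by
    rintro _ _ ⟨a, rfl⟩ ⟨b, rfl⟩
    exact ⟨sbr a b, hφ.map_sbr a b⟩
  graded := by
    rintro a b ha hb ⟨c, hc⟩
    obtain ⟨c₀, h₀, c₁, h₁, rfl⟩ := exists_homog_add c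
    rw [map_add] at hc
    obtain ⟨rfl, rfl⟩ := eq_of_homog_add_eq (hφ.map_homog h₀) (hφ.map_homog h₁) ha hb hc
    exact ⟨⟨c₀, rfl⟩, ⟨c₁, rfl⟩⟩

lemma map_mem_homog_iff {φ : L →ₗ[ℂ] M} (hφ : IsSuperHom φ) (hinj : Function.Injective φ)
    (i : ZMod 2) (a : L) :
    φ a ∈ (homog i : Submodule ℂ M) ↔ a ∈ (homog i : Submodule ℂ L) := by
  refine ⟨fun h => ?_, hφ.map_homog⟩
  obtain ⟨a₀, h₀, a₁, h₁, rfl⟩ := exists_homog_add a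
  have hφ₀ := hφ.map_homog h₀
  have hφ₁ := hφ.map_homog h₁
  rw [map_add] at h
  have zero_or_one : ∀ j : ZMod 2, j = 0 ∨ j = 1 := by decide
  rcases zero_or_one i with rfl | rfl
  · have hzero := (eq_of_homog_add_eq hφ₀ hφ₁ h (zero_mem _) (add_zero _).symm).2
    rwa [(map_eq_zero_iff φ hinj).1 hzero, add_zero]
  · have hzero := (eq_of_homog_add_eq hφ₀ hφ₁ (zero_mem _) h (zero_add _).symm).1
    rwa [(map_eq_zero_iff φ hinj).1 hzero, zero_add]

end IsSuperHom

lemma subset_superSpan (S : Set L) : S ⊆ (superSpan S).carrier := by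
  intro a ha
  refine Submodule.mem_sInf.2 ?_
  rintro _ ⟨s, rfl, hs⟩
  exact hs ha

lemma superSpan_le {S : Set L} {s : LieSubsuperalgebra L} (h : S ⊆ s.carrier) :
    (superSpan S).carrier ≤ s.carrier :=
  sInf_le ⟨s, rfl, h⟩

lemma superSpan_eq_range_of_span_eq {φ : L →ₗ[ℂ] M} (hφ : IsSuperHom φ) {S : Set M}
    (hS : Submodule.span ℂ S = LinearMap.range φ) :
    (superSpan S).carrier = LinearMap.range φ :=
  le_antisymm (superSpan_le (s := hφ.range) (Submodule.span_le.1 hS.le))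
    (hS ▸ Submodule.span_le.2 (subset_superSpan S))

lemma superIso_superSpan_of_injective {φ : L →ₗ[ℂ] M} (hφ : IsSuperHom φ)
    (hinj : Function.Injective φ) {S : Set M} (hS : Submodule.span ℂ S = LinearMap.range φ) :
    SuperIso (superSpan S).carrier L := by
  let e : L ≃ₗ[ℂ] (superSpan S).carrier := (LinearEquiv.ofInjective φ hinj).trans
    (LinearEquiv.ofEq _ _ (superSpan_eq_range_of_span_eq hφ hS).symm)
  have map_sbr (a b : L) : e (sbr a b) = sbr (e a) (e b) := Subtype.ext (hφ.map_sbr a b)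
  refine ⟨e.symm, fun a b => ?_, fun i a => ?_⟩
  · rw [LinearEquiv.symm_apply_eq, map_sbr, e.apply_symm_apply, e.apply_symm_apply]
  · obtain ⟨c, rfl⟩ := e.surjective a
    rw [e.symm_apply_apply]
    exact (hφ.map_mem_homog_iff hinj i c).symm

lemma SuperIso.finiteDimensional [FiniteDimensional ℂ M] (h : SuperIso L M) :
    FiniteDimensional ℂ L :=
  let ⟨e, _⟩ := h
  e.symm.finiteDimensional

/-- The graded subalgebra `s + ℂ c`, for an even central element `c`. -/
def LieSubsuperalgebra.adjoinCentral (s : LieSubsuperalgebra L) (c : L)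
    (heven : c ∈ (homog 0 : Submodule ℂ L)) (hc : ∀ a, sbr c a = 0) : LieSubsuperalgebra L where
  carrier := s.carrier ⊔ ℂ ∙ c
  sbr_closed := by
    intro a b ha hb
    obtain ⟨a, ha', u, hu, rfl⟩ := Submodule.mem_sup.1 ha
    obtain ⟨b, hb', v, hv, rfl⟩ := Submodule.mem_sup.1 hb
    obtain ⟨t, rfl⟩ := Submodule.mem_span_singleton.1 hu
    obtain ⟨t', rfl⟩ := Submodule.mem_span_singleton.1 hv
    simpa [hc, sbr_eq_neg_of_even heven] using Submodule.mem_sup_left (s.sbr_closed ha' hb')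
  graded := by
    intro a b ha hb hab
    obtain ⟨d, hd, u, hu, hdu⟩ := Submodule.mem_sup.1 hab
    obtain ⟨t, rfl⟩ := Submodule.mem_span_singleton.1 hu
    have hmem : (a - t • c) + b ∈ s.carrier := by
      rwa [sub_add_eq_add_sub, ← hdu, add_sub_cancel_right]
    obtain ⟨h0, h1⟩ := s.graded (Submodule.sub_mem _ ha (Submodule.smul_mem _ t heven)) hb hmem
    refine ⟨?_, Submodule.mem_sup_left h1⟩
    rw [← sub_add_cancel a (t • c)]
    exact Submodule.add_mem_sup h0 hu

lemma finiteDimensional_superSpan_insert {S : Set L} {c : L}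
    (hS : FiniteDimensional ℂ (superSpan S).carrier)
    (heven : c ∈ (homog 0 : Submodule ℂ L)) (hc : ∀ a, sbr c a = 0) :
    FiniteDimensional ℂ (superSpan (insert c S)).carrier := by
  have hle : (superSpan (insert c S)).carrier ≤ (superSpan S).carrier ⊔ ℂ ∙ c :=
    superSpan_le (s := (superSpan S).adjoinCentral c heven hc) <|
      Set.insert_subset (Submodule.mem_sup_right (Submodule.mem_span_singleton_self c))
        fun _ ha => Submodule.mem_sup_left (subset_superSpan S ha)
  exact Submodule.finiteDimensional_of_le hle

end LieSuperalgebra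

section Operators

open MvPolynomial

variable {A : Type} [CommRing A]

lemma commute_opC (T : PolyOp A) (c : A) : Commute T (opC c) :=
  (Algebra.commutes c T).symm

lemma opX_apply (i : Fin 2) (f : MvPolynomial (Fin 2) A) : opX A i f = X i * f := rfl

lemma opD_apply (i : Fin 2) (f : MvPolynomial (Fin 2) A) : opD A i f = pderiv i f := rfl

lemma commute_opX_opX (i j : Fin 2) : Commute (opX A i) (opX A j) :=
  LinearMap.ext fun f => by
    simp only [Module.End.mul_apply, opX_apply, mul_left_comm]

lemma pderiv_pderiv_comm {σ : Type*} (i j : σ) (f : MvPolynomial σ A) :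
    pderiv i (pderiv j f) = pderiv j (pderiv i f) := by
  rcases eq_or_ne i j with rfl | h
  · rfl
  · ext m
    simp only [coeff_pderiv, Finsupp.add_apply, Finsupp.single_eq_of_ne h,
      Finsupp.single_eq_of_ne h.symm, add_zero]
    rw [add_right_comm]
    ring

lemma commute_opD_opD (i j : Fin 2) : Commute (opD A i) (opD A j) :=
  LinearMap.ext fun f => by
    simp only [Module.End.mul_apply, opD_apply, pderiv_pderiv_comm i j]

lemma opD_mul_opX (i : Fin 2) : opD A i * opX A i = opX A i * opD A i + 1 :=
  LinearMap.ext fun f => by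
    simp only [Module.End.mul_apply, LinearMap.add_apply, Module.End.one_apply, opX_apply,
      opD_apply, pderiv_mul, pderiv_X_self, one_mul, add_comm]

lemma commute_opX_opD {i j : Fin 2} (h : i ≠ j) : Commute (opX A i) (opD A j) :=
  LinearMap.ext fun f => by
    simp only [Module.End.mul_apply, opX_apply, opD_apply, pderiv_mul, pderiv_X_of_ne h,
      zero_mul, zero_add]

end Operators

section GeneralLinear

variable {A : Type} [CommRing A]

/-- Multiplication by the homogeneous coordinate `z_r`, read off on dehomogenised functions:
`z₀ = 1`, `z₁ = x`. -/
def coordOp (i : Fin 2) : Fin 2 → PolyOp A := ![1, opX A i]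

/-- The derivative `∂/∂z_s` on homogeneous functions of degree `ν`, read off on their
dehomogenisations `f(x)`, `x = z₁ / z₀`. -/
def derivOp (i : Fin 2) (ν : A) : Fin 2 → PolyOp A := ![opC ν - opX A i * opD A i, opD A i]

lemma commute_coordOp {T : PolyOp A} {i : Fin 2} (hX : Commute T (opX A i)) (r : Fin 2) :
    Commute T (coordOp i r) := by
  fin_cases r
  exacts [Commute.one_right T, hX]

lemma commute_coordOp_coordOp (i r s : Fin 2) : Commute (coordOp (A := A) i r) (coordOp i s) := by
  fin_cases r <;> fin_cases s <;> simp [coordOp]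

/-- The first factor acts on functions of degree `ν - 1`. -/
lemma derivOp_mul_derivOp (i : Fin 2) (ν : A) (s t : Fin 2) :
    derivOp i (ν - 1) s * derivOp i ν t = derivOp i (ν - 1) t * derivOp i ν s := by
  have hC : opC (ν - 1) = (opC ν - 1 : PolyOp A) := by simp [opC]
  have hD : opD A i * opC ν = opC ν * opD A i := commute_opC _ _
  have key : (opC (ν - 1) - opX A i * opD A i) * opD A i =
      opD A i * (opC ν - opX A i * opD A i) := by
    rw [mul_sub, ← mul_assoc, opD_mul_opX, hD, hC]
    simp only [sub_mul, add_mul, one_mul]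
    abel
  fin_cases s <;> fin_cases t <;> simp [derivOp, key]

lemma derivOp_mul_coordOp (i : Fin 2) (ν : A) (s r : Fin 2) :
    derivOp i ν s * coordOp i r = coordOp i r * derivOp i (ν - 1) s + if r = s then 1 else 0 := by
  have hC : opC (ν - 1) = (opC ν - 1 : PolyOp A) := by simp [opC]
  have hX : opX A i * opC ν = opC ν * opX A i := commute_opC _ _
  have key : (opC ν - opX A i * opD A i) * opX A i =
      opX A i * (opC (ν - 1) - opX A i * opD A i) := by
    rw [sub_mul, mul_assoc, opD_mul_opX, ← hX, hC]
    simp only [mul_sub, mul_add, mul_one]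
    abel
  fin_cases s <;> fin_cases r <;> simp [derivOp, coordOp, hC, key, opD_mul_opX]; abel

variable [Algebra ℂ A]

/-- Multiplication by the linear form `b₀ z₀ + b₁ z₁`. -/
def vecOp (i : Fin 2) : (Fin 2 → ℂ) →ₗ[ℂ] PolyOp A := Fintype.linearCombination ℂ (coordOp i)

/-- The vector field `c₀ ∂/∂z₀ + c₁ ∂/∂z₁` on homogeneous functions of degree `ν`. -/
def covecOp (i : Fin 2) (ν : A) : (Fin 2 → ℂ) →ₗ[ℂ] PolyOp A :=
  Fintype.linearCombination ℂ (derivOp i ν)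

/-- The action `a ↦ ∑ a_rs z_r ∂/∂z_s` of `gl₂` on homogeneous functions of degree `ν`. -/
def glTwo (i : Fin 2) (ν : A) : Matrix (Fin 2) (Fin 2) ℂ →ₗ[ℂ] PolyOp A :=
  ∑ r, LinearMap.mulLeft ℂ (coordOp i r) ∘ₗ covecOp i ν ∘ₗ LinearMap.proj r

lemma vecOp_apply (i : Fin 2) (b : Fin 2 → ℂ) :
    vecOp (A := A) i b = ∑ r, b r • coordOp i r := rfl

lemma covecOp_apply (i : Fin 2) (ν : A) (c : Fin 2 → ℂ) :
    covecOp i ν c = ∑ s, c s • derivOp i ν s := rfl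

lemma glTwo_apply (i : Fin 2) (ν : A) (a : Matrix (Fin 2) (Fin 2) ℂ) :
    glTwo i ν a = ∑ r, coordOp i r * covecOp i ν (a r) := by
  simp only [glTwo, LinearMap.sum_apply]
  rfl

lemma commute_vecOp_coordOp (i : Fin 2) (b : Fin 2 → ℂ) (r : Fin 2) :
    Commute (vecOp (A := A) i b) (coordOp i r) :=
  Commute.sum_left _ _ _ fun s _ => (commute_coordOp_coordOp i s r).smul_left (b s)

lemma covecOp_mul_covecOp (i : Fin 2) (ν : A) (c c' : Fin 2 → ℂ) :
    covecOp i (ν - 1) c * covecOp i ν c' = covecOp i (ν - 1) c' * covecOp i ν c := by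
  simp only [covecOp_apply, Finset.sum_mul_sum, smul_mul_smul_comm]
  rw [Finset.sum_comm]
  exact Finset.sum_congr rfl fun s _ => Finset.sum_congr rfl fun t _ => by
    rw [derivOp_mul_derivOp, mul_comm]

lemma covecOp_mul_coordOp (i : Fin 2) (ν : A) (c : Fin 2 → ℂ) (r : Fin 2) :
    covecOp i ν c * coordOp i r = coordOp i r * covecOp i (ν - 1) c + c r • 1 := by
  simp only [covecOp_apply, Finset.sum_mul, Finset.mul_sum, smul_mul_assoc, mul_smul_comm,
    derivOp_mul_coordOp, smul_add, Finset.sum_add_distrib, smul_ite, smul_zero,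
    Finset.sum_ite_eq, Finset.mem_univ, if_true]

lemma covecOp_mul_vecOp (i : Fin 2) (ν : A) (c b : Fin 2 → ℂ) :
    covecOp i ν c * vecOp i b = vecOp i b * covecOp i (ν - 1) c + (c ⬝ᵥ b) • 1 := by
  simp only [vecOp_apply, Finset.mul_sum, Finset.sum_mul, mul_smul_comm, smul_mul_assoc,
    covecOp_mul_coordOp, smul_add, Finset.sum_add_distrib, smul_smul, dotProduct, Finset.sum_smul,
    mul_comm (c _)]

lemma vecOp_mul_covecOp (i : Fin 2) (ν : A) (b c : Fin 2 → ℂ) :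
    vecOp i b * covecOp i ν c = glTwo i ν (Matrix.vecMulVec b c) := by
  have hrow (r : Fin 2) : Matrix.vecMulVec b c r = b r • c := rfl
  simp only [glTwo_apply, hrow, map_smul, vecOp_apply, Finset.sum_mul, smul_mul_assoc,
    mul_smul_comm]

lemma glTwo_mul_vecOp (i : Fin 2) (ν : A) (a : Matrix (Fin 2) (Fin 2) ℂ) (b : Fin 2 → ℂ) :
    glTwo i ν a * vecOp i b = vecOp i b * glTwo i (ν - 1) a + vecOp i (a.mulVec b) := by
  simp only [glTwo_apply, Finset.sum_mul, Finset.mul_sum, mul_assoc, covecOp_mul_vecOp, mul_add,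
    Finset.sum_add_distrib, mul_smul_comm, mul_one, vecOp_apply i (a.mulVec b)]
  refine congrArg₂ (· + ·) (Finset.sum_congr rfl fun r _ => ?_) rfl
  rw [← mul_assoc, ← (commute_vecOp_coordOp i b r).eq, mul_assoc]

lemma covecOp_mul_glTwo (i : Fin 2) (ν : A) (c : Fin 2 → ℂ) (a : Matrix (Fin 2) (Fin 2) ℂ) :
    covecOp i ν c * glTwo i ν a = glTwo i (ν - 1) a * covecOp i ν c + covecOp i ν (a.vecMul c) := by
  have hrow : a.vecMul c = ∑ r, c r • a r := Matrix.vecMul_eq_sum c a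
  simp only [glTwo_apply, Finset.sum_mul, Finset.mul_sum, ← mul_assoc, covecOp_mul_coordOp,
    add_mul, Finset.sum_add_distrib, hrow, map_sum, map_smul, smul_mul_assoc, one_mul]
  refine congrArg₂ (· + ·) (Finset.sum_congr rfl fun r _ => ?_) rfl
  rw [mul_assoc, covecOp_mul_covecOp, ← mul_assoc]

/-- Normal ordering: the second-order term is symmetric in `a` and `b`. -/
lemma glTwo_mul_glTwo (i : Fin 2) (ν : A) (a b : Matrix (Fin 2) (Fin 2) ℂ) :
    glTwo i ν a * glTwo i ν b = glTwo i ν (a * b) + ∑ r, ∑ s,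
      coordOp i r * coordOp i s * (covecOp i (ν - 1) (a r) * covecOp i ν (b s)) := by
  have hrow (r : Fin 2) : (a * b) r = ∑ s, a r s • b s := Matrix.vecMul_eq_sum (a r) b
  rw [glTwo_apply, glTwo_apply, Finset.sum_mul_sum, glTwo_apply]
  simp only [hrow, map_sum, map_smul, Finset.mul_sum, ← Finset.sum_add_distrib]
  refine Finset.sum_congr rfl fun r _ => Finset.sum_congr rfl fun s _ => ?_
  rw [mul_assoc, ← mul_assoc (covecOp i ν (a r)), covecOp_mul_coordOp, add_mul, smul_mul_assoc,
    one_mul, mul_add, add_comm, mul_assoc, mul_assoc]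

lemma glTwo_mul_sub (i : Fin 2) (ν : A) (a b : Matrix (Fin 2) (Fin 2) ℂ) :
    glTwo i ν a * glTwo i ν b - glTwo i ν b * glTwo i ν a = glTwo i ν (a * b - b * a) := by
  have hsymm : ∑ r, ∑ s, coordOp i r * coordOp i s *
        (covecOp i (ν - 1) (a r) * covecOp i ν (b s)) =
      ∑ r, ∑ s, coordOp i r * coordOp i s *
        (covecOp i (ν - 1) (b r) * covecOp i ν (a s)) := by
    rw [Finset.sum_comm]
    exact Finset.sum_congr rfl fun r _ => Finset.sum_congr rfl fun s _ => by
      rw [covecOp_mul_covecOp, (commute_coordOp_coordOp i s r).eq]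
  rw [glTwo_mul_glTwo, glTwo_mul_glTwo, hsymm, map_sub, add_sub_add_right_eq_sub]

lemma commute_vecOp {T : PolyOp A} {i : Fin 2} (hX : Commute T (opX A i)) (b : Fin 2 → ℂ) :
    Commute T (vecOp i b) :=
  Commute.sum_right _ _ _ fun r _ => (commute_coordOp hX r).smul_right _

lemma commute_covecOp {T : PolyOp A} {i : Fin 2} (hX : Commute T (opX A i))
    (hD : Commute T (opD A i)) (ν : A) (c : Fin 2 → ℂ) : Commute T (covecOp i ν c) := by
  have hderiv (s : Fin 2) : Commute T (derivOp i ν s) := by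
    fin_cases s
    exacts [(commute_opC T ν).sub_right (hX.mul_right hD), hD]
  exact Commute.sum_right _ _ _ fun s _ => (hderiv s).smul_right _

lemma commute_glTwo {T : PolyOp A} {i : Fin 2} (hX : Commute T (opX A i))
    (hD : Commute T (opD A i)) (ν : A) (a : Matrix (Fin 2) (Fin 2) ℂ) :
    Commute T (glTwo i ν a) := by
  rw [glTwo_apply]
  exact Commute.sum_right _ _ _ fun r _ =>
    (commute_coordOp hX r).mul_right (commute_covecOp hX hD ν (a r))

lemma commute_glTwo_glTwo {i j : Fin 2} (h : i ≠ j) (ν μ : A) (a b : Matrix (Fin 2) (Fin 2) ℂ) :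
    Commute (glTwo i ν a) (glTwo j μ b) :=
  commute_glTwo (commute_glTwo (commute_opX_opX j i) (commute_opX_opD h.symm) ν a).symm
    (commute_glTwo (commute_opX_opD h).symm (commute_opD_opD j i) ν a).symm μ b

/-- Euler's relation. -/
lemma glTwo_one (i : Fin 2) (ν : A) : glTwo i ν 1 = opC ν := by
  simp [glTwo_apply, covecOp_apply, coordOp, derivOp]

lemma covecOp_mul_opX_sub (i : Fin 2) (ν : A) (c : Fin 2 → ℂ) :
    covecOp i ν c * opX A i - opX A i * covecOp i ν c = c 1 • 1 - c 0 • opX A i := by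
  have hshift : covecOp i (ν - 1) c = covecOp i ν c - c 0 • 1 := by
    simp only [covecOp_apply, derivOp, opC, map_sub, map_one, Fin.sum_univ_two,
      Matrix.cons_val_zero, Matrix.cons_val_one]
    module
  have hcoord : opX A i = coordOp i 1 := rfl
  rw [hcoord, covecOp_mul_coordOp, hshift, mul_sub, mul_smul_comm, mul_one]
  abel

lemma glTwo_mul_opX_sub (i : Fin 2) (ν : A) (a : Matrix (Fin 2) (Fin 2) ℂ) :
    glTwo i ν a * opX A i - opX A i * glTwo i ν a =
      a 0 1 • 1 + (a 1 1 - a 0 0) • opX A i - a 1 0 • opX A i ^ 2 := by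
  have hX (r : Fin 2) : opX A i * coordOp i r = coordOp i r * opX A i :=
    (commute_coordOp_coordOp i 1 r).eq
  simp only [glTwo_apply, Finset.sum_mul, Finset.mul_sum, mul_assoc, ← Finset.sum_sub_distrib]
  simp only [← mul_assoc (opX A i), hX, mul_assoc (coordOp i _), ← mul_sub, covecOp_mul_opX_sub]
  simp only [Fin.sum_univ_two, coordOp, Matrix.cons_val_zero, Matrix.cons_val_one, one_mul,
    mul_sub, mul_smul_comm, mul_one, ← pow_two]
  module

lemma transcendental_opX [Nontrivial A] (i : Fin 2) : Transcendental ℂ (opX A i) := by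
  have htrans : Transcendental A (Algebra.lmul A (MvPolynomial (Fin 2) A) (MvPolynomial.X i)) :=
    fun h => MvPolynomial.transcendental_X A i <|
      (isAlgebraic_algHom_iff _ Algebra.lmul_injective).1 h
  exact htrans.restrictScalars (algebraMap ℂ A).injective

lemma eq_zero_of_opX_quadratic_eq_zero [Nontrivial A] {i : Fin 2} {p q r : ℂ}
    (h : p • 1 + q • opX A i + r • opX A i ^ 2 = 0) : p = 0 ∧ q = 0 ∧ r = 0 := by
  open Polynomial in
  have hpoly : C p + C q * X + C r * X ^ 2 = 0 :=
    transcendental_iff.1 (transcendental_opX (A := A) i) _ <| by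
      simpa [Algebra.algebraMap_eq_smul_one] using h
  refine ⟨?_, ?_, ?_⟩
  · simpa using congrArg (Polynomial.coeff · 0) hpoly
  · simpa using congrArg (Polynomial.coeff · 1) hpoly
  · simpa using congrArg (Polynomial.coeff · 2) hpoly

variable [Nontrivial A]

lemma vecOp_injective (i : Fin 2) : Function.Injective (vecOp (A := A) i) := by
  refine (injective_iff_map_eq_zero _).2 fun b hb => ?_
  obtain ⟨h0, h1, -⟩ := eq_zero_of_opX_quadratic_eq_zero (A := A) (i := i) (p := b 0) (q := b 1)
    (r := 0) (by simpa [vecOp_apply, coordOp] using hb)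
  ext r
  fin_cases r <;> assumption

lemma covecOp_injective (i : Fin 2) (ν : A) : Function.Injective (covecOp i ν) := by
  refine (injective_iff_map_eq_zero _).2 fun c hc => ?_
  have hcomm := covecOp_mul_opX_sub i ν c
  rw [hc, zero_mul, mul_zero, sub_zero] at hcomm
  obtain ⟨h1, h0, -⟩ := eq_zero_of_opX_quadratic_eq_zero (A := A) (i := i) (p := c 1)
    (q := -c 0) (r := 0) (by rw [hcomm]; module)
  ext s
  fin_cases s
  exacts [neg_eq_zero.1 h0, h1]

lemma eq_smul_one_of_commute_glTwo_opX {i : Fin 2} {ν : A} {a : Matrix (Fin 2) (Fin 2) ℂ}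
    (h : Commute (glTwo i ν a) (opX A i)) : a = a 0 0 • (1 : Matrix (Fin 2) (Fin 2) ℂ) := by
  have hcomm := glTwo_mul_opX_sub i ν a
  rw [h.eq, sub_self] at hcomm
  obtain ⟨h01, h11, h10⟩ := eq_zero_of_opX_quadratic_eq_zero (A := A) (i := i) (p := a 0 1)
    (q := a 1 1 - a 0 0) (r := -a 1 0) (by rw [hcomm]; module)
  ext r s
  fin_cases r <;> fin_cases s <;> simp_all [sub_eq_zero]

lemma SL2.eq_zero_of_commute_glTwo_opX {i : Fin 2} {ν : A} {a : SL2}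
    (h : Commute (glTwo i ν a.1) (opX A i)) : a = 0 := by
  have hscalar := eq_smul_one_of_commute_glTwo_opX h
  have htrace : Matrix.trace a.1 = 0 := a.2
  have hzero : a.1 0 0 = 0 := by
    rw [hscalar, Matrix.trace_smul, Matrix.trace_one] at htrace
    simpa using htrace
  exact Subtype.ext (by rw [hscalar, hzero, zero_smul]; rfl)

end GeneralLinear

section SuperMatrices

lemma superCommutator_apply {ι : Type} [Fintype ι] {E : Type*} [Ring E] [Algebra ℂ E]
    (p : ι → ZMod 2) (a b : Matrix ι ι E) (i j : ι) :
    superCommutator p a b i j = ∑ r, (a i r * b r j -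
      superSign (p r + p j) (p i + p r) • (b i r * a r j)) := by
  have huniv : (Finset.univ : Finset (ZMod 2)) = {0, 1} := by decide
  have zero_or_one : ∀ k : ZMod 2, k = 0 ∨ k = 1 := by decide
  simp only [superCommutator, Matrix.add_apply, Matrix.sub_apply, Matrix.smul_apply,
    Matrix.mul_apply, superComponent, Matrix.of_apply, huniv, Finset.sum_pair zero_ne_one,
    Finset.smul_sum, ← Finset.sum_sub_distrib, ← Finset.sum_add_distrib]
  refine Finset.sum_congr rfl fun r _ => ?_
  rcases zero_or_one (p i + p r) with h | h <;> rcases zero_or_one (p r + p j) with h' | h' <;>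
    simp [h, h', superSign, sub_eq_add_neg, add_comm]

/-- The even-even block of a matrix of block format `2 + 1`. -/
def evenBlock : Matrix (Fin 3) (Fin 3) ℂ →ₗ[ℂ] Matrix (Fin 2) (Fin 2) ℂ where
  toFun a := !![a 0 0, a 0 1; a 1 0, a 1 1]
  map_add' a b := by simp
  map_smul' t a := by simp

/-- The column of a matrix of block format `2 + 1` that maps odd to even. -/
def oddColumn : Matrix (Fin 3) (Fin 3) ℂ →ₗ[ℂ] Fin 2 → ℂ where
  toFun a := ![a 0 2, a 1 2]
  map_add' a b := by simp
  map_smul' t a := by simp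

/-- The row of a matrix of block format `2 + 1` that maps even to odd. -/
def oddRow : Matrix (Fin 3) (Fin 3) ℂ →ₗ[ℂ] Fin 2 → ℂ where
  toFun a := ![a 2 0, a 2 1]
  map_add' a b := by simp
  map_smul' t a := by simp

lemma evenBlock_apply (a : Matrix (Fin 3) (Fin 3) ℂ) :
    evenBlock a = !![a 0 0, a 0 1; a 1 0, a 1 1] := rfl

lemma oddColumn_apply (a : Matrix (Fin 3) (Fin 3) ℂ) : oddColumn a = ![a 0 2, a 1 2] := rfl

lemma oddRow_apply (a : Matrix (Fin 3) (Fin 3) ℂ) : oddRow a = ![a 2 0, a 2 1] := rfl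

lemma eq_zero_of_blocks_eq_zero {a : Matrix (Fin 3) (Fin 3) ℂ} (hblock : evenBlock a = 0)
    (hcolumn : oddColumn a = 0) (hrow : oddRow a = 0) (hcorner : a 2 2 = 0) : a = 0 := by
  have hb (r s : Fin 2) : evenBlock a r s = 0 := by rw [hblock]; rfl
  ext r s
  fin_cases r <;> fin_cases s
  exacts [hb 0 0, hb 0 1, congrFun hcolumn 0, hb 1 0, hb 1 1, congrFun hcolumn 1,
    congrFun hrow 0, congrFun hrow 1, hcorner]

open Matrix in
lemma superCommutator_parity21 (a b : Matrix (Fin 3) (Fin 3) ℂ) :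
    evenBlock (superCommutator parity21 a b) =
        evenBlock a * evenBlock b - evenBlock b * evenBlock a +
        vecMulVec (oddColumn a) (oddRow b) + vecMulVec (oddColumn b) (oddRow a) ∧
      oddColumn (superCommutator parity21 a b) =
        evenBlock a *ᵥ oddColumn b + b 2 2 • oddColumn a -
        evenBlock b *ᵥ oddColumn a - a 2 2 • oddColumn b ∧
      oddRow (superCommutator parity21 a b) =
        oddRow a ᵥ* evenBlock b + a 2 2 • oddRow b -
        oddRow b ᵥ* evenBlock a - b 2 2 • oddRow a ∧
      superCommutator parity21 a b 2 2 =
        oddRow a ⬝ᵥ oddColumn b + oddRow b ⬝ᵥ oddColumn a := by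
  simp only [evenBlock_apply, oddColumn_apply, oddRow_apply]
  refine ⟨?_, ?_, ?_, ?_⟩
  · ext r s
    simp only [Matrix.add_apply, Matrix.sub_apply, mul_apply, vecMulVec_apply, Fin.sum_univ_two]
    fin_cases r <;> fin_cases s <;>
      simp [superCommutator_apply, parity21, superSign, Fin.sum_univ_three] <;> ring
  · ext r
    simp only [Pi.add_apply, Pi.sub_apply, mulVec, dotProduct, Fin.sum_univ_two]
    fin_cases r <;>
      simp [superCommutator_apply, parity21, superSign, Fin.sum_univ_three] <;> ring
  · ext s
    simp only [Pi.add_apply, Pi.sub_apply, vecMul, dotProduct, Fin.sum_univ_two]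
    fin_cases s <;>
      simp [superCommutator_apply, parity21, superSign, Fin.sum_univ_three] <;> ring
  · simp [superCommutator_apply, parity21, superSign, Fin.sum_univ_three]
    ring

variable {A : Type} [CommRing A]

/-- The operator with blocks `P : F → F`, `Q : θG → F`, `R : F → θG`, `S : θG → θG`, as a `2 × 2`
matrix in which `θG` has index `i` and `F` the other one. -/
def opBlock (i : Fin 2) (P Q R S : PolyOp A) : Matrix (Fin 2) (Fin 2) (PolyOp A) :=
  if i = 0 then !![S, R; Q, P] else !![P, Q; R, S]

lemma opBlock_add (i : Fin 2) (P Q R S P' Q' R' S' : PolyOp A) :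
    opBlock i (P + P') (Q + Q') (R + R') (S + S') =
      opBlock i P Q R S + opBlock i P' Q' R' S' := by
  fin_cases i <;> simp [opBlock]

lemma opBlock_inj {i : Fin 2} {P Q R S P' Q' R' S' : PolyOp A} :
    opBlock i P Q R S = opBlock i P' Q' R' S' ↔ P = P' ∧ Q = Q' ∧ R = R' ∧ S = S' := by
  fin_cases i <;> simp [opBlock] <;> tauto

lemma opBlock_eq_zero {i : Fin 2} {P Q R S : PolyOp A} :
    opBlock i P Q R S = 0 ↔ P = 0 ∧ Q = 0 ∧ R = 0 ∧ S = 0 := by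
  fin_cases i <;> simp [opBlock, ← Matrix.ext_iff] <;> tauto

lemma opBlock_zero_zero_self (i : Fin 2) (T : PolyOp A) : opBlock i T 0 0 T = opDiag T T := by
  fin_cases i <;> rfl

variable [Algebra ℂ A]

lemma opBlock_smul (i : Fin 2) (t : ℂ) (P Q R S : PolyOp A) :
    opBlock i (t • P) (t • Q) (t • R) (t • S) = t • opBlock i P Q R S := by
  fin_cases i <;> simp [opBlock]

lemma superCommutator_opBlock (i : Fin 2) (P Q R S P' Q' R' S' : PolyOp A) :
    superCommutator parity11 (opBlock i P Q R S) (opBlock i P' Q' R' S') = opBlock i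
      (P * P' - P' * P + Q * R' + Q' * R) (P * Q' + Q * S' - P' * Q - Q' * S)
      (R * P' + S * R' - R' * P - S' * R) (S * S' - S' * S + R * Q' + R' * Q) := by
  ext1 r s
  fin_cases i <;> fin_cases r <;> fin_cases s <;>
    simp [opBlock, superCommutator_apply, parity11, superSign] <;> abel

lemma opDiag_mem_even (P S : PolyOp A) :
    opDiag P S ∈ superHomogeneous parity11 (PolyOp A) 0 := by
  intro r s
  fin_cases r <;> fin_cases s <;> simp [opDiag, parity11, CharTwo.add_self_eq_zero]

lemma opBlock_mem_even (i : Fin 2) (P S : PolyOp A) :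
    opBlock i P 0 0 S ∈ superHomogeneous parity11 (PolyOp A) 0 := by
  fin_cases i
  exacts [opDiag_mem_even S P, opDiag_mem_even P S]

lemma opBlock_mem_odd (i : Fin 2) (Q R : PolyOp A) :
    opBlock i 0 Q R 0 ∈ superHomogeneous parity11 (PolyOp A) 1 := by
  intro r s
  fin_cases i <;> fin_cases r <;> fin_cases s <;> simp [opBlock, parity11]

/-- The action of `gl(2|1)` on `F_ν ⊕ θF_{ν-1}`, where `F_ν` are the homogeneous functions of degree
`ν` in `z₀`, `z₁` and `θ` is an odd variable; the part `θF_{ν-1}` has index `i` in the `2 × 2`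
matrices of operators. -/
def glSuper (i : Fin 2) (ν : A) : SuperMatrix parity21 ℂ →ₗ[ℂ] MatOp A :=
  let φ : Matrix (Fin 3) (Fin 3) ℂ →ₗ[ℂ] Matrix (Fin 2) (Fin 2) (PolyOp A) :=
    { toFun a := opBlock i (glTwo i ν (evenBlock a)) (vecOp i (oddColumn a))
        (covecOp i ν (oddRow a)) (glTwo i (ν - 1) (evenBlock a) + a 2 2 • 1)
      map_add' a b := by
        simp only [map_add, Matrix.add_apply, add_smul, add_add_add_comm, opBlock_add]
      map_smul' t a := by
        simp only [map_smul, Matrix.smul_apply, smul_assoc, ← smul_add, opBlock_smul,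
          RingHom.id_apply] }
  φ

lemma glSuper_apply (i : Fin 2) (ν : A) (a : Matrix (Fin 3) (Fin 3) ℂ) :
    glSuper i ν a = opBlock i (glTwo i ν (evenBlock a)) (vecOp i (oddColumn a))
      (covecOp i ν (oddRow a)) (glTwo i (ν - 1) (evenBlock a) + a 2 2 • 1) := rfl

lemma isSuperHom_glSuper (i : Fin 2) (ν : A) : IsSuperHom (glSuper i ν) where
  map_sbr := by
    intro (a : Matrix (Fin 3) (Fin 3) ℂ) (b : Matrix (Fin 3) (Fin 3) ℂ)
    obtain ⟨hblock, hcolumn, hrow, hcorner⟩ := superCommutator_parity21 a b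
    refine (glSuper_apply i ν (superCommutator parity21 a b)).trans <| .trans ?_
      (superCommutator_opBlock i _ _ _ _ _ _ _ _).symm
    rw [hblock, hcolumn, hrow, hcorner]
    refine opBlock_inj.2 ⟨?_, ?_, ?_, ?_⟩
    · simp only [map_add, ← glTwo_mul_sub, ← vecOp_mul_covecOp]
    · simp only [map_add, map_sub, map_smul, glTwo_mul_vecOp, mul_add, mul_smul_comm, mul_one]
      abel
    · simp only [map_add, map_sub, map_smul, covecOp_mul_glTwo, add_mul, smul_mul_assoc, one_mul]
      abel
    · simp only [map_add, ← glTwo_mul_sub, covecOp_mul_vecOp, vecOp_mul_covecOp, add_mul, mul_add,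
        mul_smul_comm, smul_mul_assoc, mul_one, one_mul]
      module
  map_homog := by
    intro k (a : Matrix (Fin 3) (Fin 3) ℂ) (ha : a ∈ superHomogeneous parity21 ℂ k)
    have zero_or_one : ∀ j : ZMod 2, j = 0 ∨ j = 1 := by decide
    rcases zero_or_one k with rfl | rfl
    · have hcolumn : oddColumn a = 0 := by
        rw [oddColumn_apply, ha 0 2 (by decide), ha 1 2 (by decide)]
        simp
      have hrow : oddRow a = 0 := by
        rw [oddRow_apply, ha 2 0 (by decide), ha 2 1 (by decide)]
        simp
      rw [glSuper_apply, hcolumn, hrow, map_zero, map_zero]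
      exact opBlock_mem_even i _ _
    · have hblock : evenBlock a = 0 := by
        rw [evenBlock_apply, ha 0 0 (by decide), ha 0 1 (by decide), ha 1 0 (by decide),
          ha 1 1 (by decide)]
        exact (Matrix.eta_fin_two 0).symm
      rw [glSuper_apply, hblock, ha 2 2 (by decide), map_zero, map_zero, zero_smul, add_zero]
      exact opBlock_mem_odd i _ _

end SuperMatrices

section Embedding

variable {A : Type} [CommRing A] [Algebra ℂ A]

lemma superCommutator_opDiag_self (T : PolyOp A) (M : Matrix (Fin 2) (Fin 2) (PolyOp A))
    (r s : Fin 2) :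
    superCommutator parity11 (opDiag T T) M r s = T * M r s - M r s * T := by
  fin_cases r <;> fin_cases s <;> simp [superCommutator_apply, opDiag, superSign, parity11]

lemma sbr_opDiag_eq_zero {T : PolyOp A} {M : Matrix (Fin 2) (Fin 2) (PolyOp A)}
    (h : ∀ r s, Commute T (M r s)) : sbr (L := MatOp A) (opDiag T T) M = 0 :=
  Matrix.ext fun r s =>
    (superCommutator_opDiag_self T M r s).trans (sub_eq_zero.2 (h r s).eq)

/-- The action of `sl₂` on homogeneous functions, as scalar matrices of operators. -/
def slDiag (j : Fin 2) (μ : A) : SL2 →ₗ[ℂ] MatOp A :=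
  let φ : SL2 →ₗ[ℂ] Matrix (Fin 2) (Fin 2) (PolyOp A) :=
    { toFun a := opDiag (glTwo j μ a.1) (glTwo j μ a.1)
      map_add' a b := by simp [opDiag]
      map_smul' t a := by simp [opDiag] }
  φ

lemma slDiag_apply (j : Fin 2) (μ : A) (a : SL2) :
    slDiag j μ a = opDiag (glTwo j μ a.1) (glTwo j μ a.1) := rfl

lemma slDiag_mem_even (j : Fin 2) (μ : A) (a : SL2) :
    slDiag j μ a ∈ (homog 0 : Submodule ℂ (MatOp A)) :=
  opDiag_mem_even _ _

lemma isSuperHom_slDiag (j : Fin 2) (μ : A) : IsSuperHom (slDiag j μ) where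
  map_sbr a b := by
    refine Matrix.ext fun r s => .trans ?_ (superCommutator_opDiag_self _ _ r s).symm
    change slDiag j μ ⁅a, b⁆ r s = _
    rw [slDiag_apply]
    have hbracket := glTwo_mul_sub j μ a.1 b.1
    fin_cases r <;> fin_cases s <;> simp [opDiag, slDiag_apply, hbracket, Ring.lie_def]
  map_homog := by
    intro k a ha
    have zero_or_one : ∀ j : ZMod 2, j = 0 ∨ j = 1 := by decide
    rcases zero_or_one k with rfl | rfl
    · exact slDiag_mem_even j μ a
    · rw [(Submodule.mem_bot ℂ).1 ha, map_zero]
      exact zero_mem _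

lemma commute_glSuper {T : PolyOp A} {i : Fin 2} (hX : Commute T (opX A i))
    (hD : Commute T (opD A i)) (ν : A) (a : Matrix (Fin 3) (Fin 3) ℂ) (r s : Fin 2) :
    Commute T (glSuper i ν a r s) := by
  have hP := commute_glTwo hX hD ν (evenBlock a)
  have hQ := commute_vecOp hX (oddColumn a)
  have hR := commute_covecOp hX hD ν (oddRow a)
  have hS := (commute_glTwo hX hD (ν - 1) (evenBlock a)).add_right
    ((Commute.one_right T).smul_right (a 2 2))
  rw [glSuper_apply]
  fin_cases i <;> fin_cases r <;> fin_cases s <;> assumption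

/-- The action of `spl(2,1) ⊕ sl₂` on `(F_ν ⊕ θF_{ν-1}) ⊗ F_μ`, with the functions of degree `ν` in
the variable `i` and those of degree `μ` in the variable `j`. -/
def splEmbedding (i j : Fin 2) (ν μ : A) : spl21.carrier × SL2 →ₗ[ℂ] MatOp A :=
  (glSuper i ν ∘ₗ spl21.carrier.subtype).coprod (slDiag j μ)

lemma isSuperHom_splEmbedding {i j : Fin 2} (h : i ≠ j) (ν μ : A) :
    IsSuperHom (splEmbedding i j ν μ) :=
  ((isSuperHom_glSuper i ν).comp_subtype spl21).coprod (isSuperHom_slDiag j μ)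
    (slDiag_mem_even j μ) fun a b => sbr_opDiag_eq_zero <|
      commute_glSuper (commute_glTwo (commute_opX_opX i j) (commute_opX_opD h) μ b.1).symm
        (commute_glTwo (commute_opX_opD h.symm).symm (commute_opD_opD i j) μ b.1).symm ν a.1

lemma splEmbedding_injective [Nontrivial A] {i j : Fin 2} (h : i ≠ j) (ν μ : A) :
    Function.Injective (splEmbedding i j ν μ) := by
  refine (injective_iff_map_eq_zero _).2 ?_
  rintro ⟨⟨(a : Matrix (Fin 3) (Fin 3) ℂ), ha⟩, b⟩ hab
  have hstr : a 0 0 + a 1 1 - a 2 2 = 0 := ha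
  have hsum : glSuper i ν a + slDiag j μ b = 0 := hab
  rw [glSuper_apply, slDiag_apply, ← opBlock_zero_zero_self i] at hsum
  obtain ⟨hP, hQ, hR, hS⟩ := opBlock_eq_zero.1 <| (opBlock_add i _ _ _ _ _ _ _ _).trans hsum
  obtain rfl : b = 0 := by
    refine SL2.eq_zero_of_commute_glTwo_opX (i := j) (ν := μ) ?_
    rw [eq_neg_of_add_eq_zero_right hP]
    exact (commute_glTwo (commute_opX_opX j i) (commute_opX_opD h.symm) ν _).symm.neg_left
  simp only [ZeroMemClass.coe_zero, map_zero, add_zero] at hP hQ hR hS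
  have hblock : evenBlock a = a 0 0 • (1 : Matrix (Fin 2) (Fin 2) ℂ) :=
    eq_smul_one_of_commute_glTwo_opX (hP ▸ Commute.zero_left (opX A i))
  have hcolumn := (map_eq_zero_iff _ (vecOp_injective i)).1 hQ
  have hrow := (map_eq_zero_iff _ (covecOp_injective i ν)).1 hR
  have hcorner : a 2 2 = a 0 0 := by
    have hC : opC (ν - 1) = (opC ν - 1 : PolyOp A) := by simp [opC]
    rw [hblock, map_smul, glTwo_one] at hP hS
    rw [hC, smul_sub, hP, zero_sub, neg_add_eq_zero] at hS
    exact (smul_left_injective ℂ one_ne_zero hS).symm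
  have h11 : a 1 1 = a 0 0 := by simpa [evenBlock_apply] using congrFun₂ hblock 1 1
  have h00 : a 0 0 = 0 := by linear_combination hstr - h11 + hcorner
  obtain rfl : a = 0 := eq_zero_of_blocks_eq_zero (by rw [hblock, h00, zero_smul]) hcolumn hrow
    (hcorner.trans h00)
  rfl

end Embedding

section Generators

lemma mem_sl_two {a : Matrix (Fin 2) (Fin 2) ℂ} :
    a ∈ LieAlgebra.SpecialLinear.sl (Fin 2) ℂ ↔ a 0 0 + a 1 1 = 0 := by
  rw [← Matrix.trace_fin_two]
  rfl

/-- The element of `sl₂` that acts as `J⁺ = -z₁ ∂/∂z₀`. -/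
def slPlus : SL2 := ⟨!![0, 0; -1, 0], by simp [mem_sl_two]⟩

/-- The element of `sl₂` that acts as `J⁻ = z₀ ∂/∂z₁`. -/
def slMinus : SL2 := ⟨!![0, 1; 0, 0], by simp [mem_sl_two]⟩

/-- The element of `sl₂` that acts as `J⁰ = (z₁ ∂/∂z₁ - z₀ ∂/∂z₀) / 2`. -/
def slZero : SL2 := ⟨!![-(1 / 2), 0; 0, 1 / 2], by simp [mem_sl_two]⟩

lemma span_slPlus_slMinus_slZero : Submodule.span ℂ {slPlus, slMinus, slZero} = ⊤ := by
  refine eq_top_iff.2 fun a _ => ?_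
  have htrace : a.1 0 0 + a.1 1 1 = 0 := mem_sl_two.1 a.2
  refine Submodule.mem_span_triple.2 ⟨-a.1 1 0, a.1 0 1, a.1 1 1 - a.1 0 0, Subtype.ext ?_⟩
  ext r s
  fin_cases r <;> fin_cases s <;> simp [slPlus, slMinus, slZero]
  all_goals linear_combination (-1 / 2) * htrace

variable {A : Type} [CommRing A] [Algebra ℂ A]

lemma half_eq (ν : A) : opC (half ν) = (1 / 2 : ℂ) • (opC ν : PolyOp A) := by
  ext
  simp [opC, half]

lemma glTwo_slPlus (i : Fin 2) (ν : A) : glTwo i ν slPlus.1 = opPlus i ν := by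
  have hX : opX A i * opC ν = opC ν * opX A i := commute_opC _ _
  simp [glTwo_apply, covecOp_apply, coordOp, derivOp, slPlus, opPlus, mul_sub, hX, sq, mul_assoc]

lemma glTwo_slMinus (i : Fin 2) (ν : A) : glTwo i ν slMinus.1 = opD A i := by
  simp [glTwo_apply, covecOp_apply, coordOp, derivOp, slMinus]

lemma glTwo_slZero (i : Fin 2) (ν : A) : glTwo i ν slZero.1 = opZero i ν := by
  simp only [glTwo_apply, covecOp_apply, coordOp, derivOp, slZero, opZero, half_eq,
    Fin.sum_univ_two]
  simp
  module

/-- The operators `T⁺`, `T⁻`, `T⁰` for `Γ = 0`, in the variable `j`. -/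
def slGens (j : Fin 2) (μ : A) : Set (Matrix (Fin 2) (Fin 2) (PolyOp A)) :=
  {opDiag (opPlus j μ) (opPlus j μ), opDiag (opD A j) (opD A j), opDiag (opZero j μ) (opZero j μ)}

lemma span_slGens (j : Fin 2) (μ : A) :
    Submodule.span ℂ (slGens j μ : Set (MatOp A)) = LinearMap.range (slDiag j μ) := by
  rw [LinearMap.range_eq_map, ← span_slPlus_slMinus_slZero, Submodule.map_span]
  simp only [Set.image_insert_eq, Set.image_singleton, slDiag_apply, glTwo_slPlus, glTwo_slMinus,
    glTwo_slZero]
  rfl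

/-- The operators `S⁺`, `S⁻`, `S⁰`, `J`, `Q⁻`, `Q⁺` for `Δ = 1`, `Γ = 0`, with index `i` in the
role of the index `0` (the variable `x`, and the row and column of lower degree). -/
def splGens (i : Fin 2) (ν : A) : Set (Matrix (Fin 2) (Fin 2) (PolyOp A)) :=
  {opBlock i (opPlus i ν) 0 0 (opPlus i (ν - 1)), opBlock i (opD A i) 0 0 (opD A i),
    opBlock i (opZero i ν) 0 0 (opZero i (ν - 1)),
    opBlock i (opC (half ν)) 0 0 (opC (half (ν + 1))),
    opBlock i 0 1 0 0, opBlock i 0 (opX A i) 0 0,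
    opBlock i 0 0 (opX A i * opD A i - opC ν) 0, opBlock i 0 0 (opD A i) 0}

/-- Matrices that span `spl(2,1)`; those of `S⁺`, `S⁻`, `S⁰`, `J`, `Q⁻` and `Q⁺`. -/
def spl21Gens : Set (Matrix (Fin 3) (Fin 3) ℂ) :=
  {!![0, 0, 0; -1, 0, 0; 0, 0, 0], !![0, 1, 0; 0, 0, 0; 0, 0, 0],
    !![-(1 / 2), 0, 0; 0, 1 / 2, 0; 0, 0, 0], !![1 / 2, 0, 0; 0, 1 / 2, 0; 0, 0, 1],
    !![0, 0, 1; 0, 0, 0; 0, 0, 0], !![0, 0, 0; 0, 0, 1; 0, 0, 0],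
    !![0, 0, 0; 0, 0, 0; -1, 0, 0], !![0, 0, 0; 0, 0, 0; 0, 1, 0]}

lemma spl21Gens_subset : spl21Gens ⊆ {a | a 0 0 + a 1 1 - a 2 2 = 0} := by
  simp [spl21Gens, Set.insert_subset_iff]
  norm_num

lemma mem_span_spl21Gens {a : Matrix (Fin 3) (Fin 3) ℂ} (ha : a 0 0 + a 1 1 - a 2 2 = 0) :
    a ∈ Submodule.span ℂ spl21Gens := by
  simp only [spl21Gens, Submodule.mem_span_insert, Submodule.mem_span_singleton]
  refine ⟨-a 1 0, _, ⟨a 0 1, _, ⟨a 1 1 - a 0 0, _, ⟨a 2 2, _, ⟨a 0 2, _, ⟨a 1 2, _, ⟨-a 2 0, _,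
    ⟨a 2 1, rfl⟩, rfl⟩, rfl⟩, rfl⟩, rfl⟩, rfl⟩, rfl⟩, ?_⟩
  ext r s
  fin_cases r <;> fin_cases s <;> simp
  all_goals linear_combination ha / 2

lemma span_spl21Gens : Submodule.span ℂ (spl21Gens : Set (SuperMatrix parity21 ℂ)) =
    spl21.carrier :=
  le_antisymm (Submodule.span_le.2 spl21Gens_subset) fun _ => mem_span_spl21Gens

lemma image_spl21Gens (i : Fin 2) (ν : A) :
    (fun a : Matrix (Fin 3) (Fin 3) ℂ => glSuper i ν a) '' spl21Gens = splGens i ν := by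
  have hcorner : opC (half (ν - 1)) + 1 = (opC (half (ν + 1)) : PolyOp A) := by
    simp only [opC, half, ← map_one (algebraMap A (PolyOp A)), ← map_add]
    congr 1
    module
  have hplus (ν : A) : glTwo i ν !![0, 0; -1, 0] = opPlus i ν := glTwo_slPlus i ν
  have hminus (ν : A) : glTwo i ν !![0, 1; 0, 0] = opD A i := glTwo_slMinus i ν
  have hzero (ν : A) : glTwo i ν !![-(1 / 2), 0; 0, 1 / 2] = opZero i ν := glTwo_slZero i ν
  have hhalf (ν : A) : glTwo i ν !![1 / 2, 0; 0, 1 / 2] = opC (half ν) := by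
    rw [show !![(1 / 2 : ℂ), 0; 0, 1 / 2] = (1 / 2 : ℂ) • 1 by simp [Matrix.one_fin_two],
      map_smul, glTwo_one, half_eq]
  have hrow : covecOp i ν ![-1, 0] = opX A i * opD A i - opC ν := by
    simp only [covecOp_apply, derivOp, Fin.sum_univ_two, Matrix.cons_val]
    module
  have hblock : !![(0 : ℂ), 0; 0, 0] = 0 := (Matrix.eta_fin_two 0).symm
  simp only [spl21Gens, splGens]
  repeat rw [Set.image_insert_eq]
  rw [Set.image_singleton]
  simp only [glSuper_apply, evenBlock_apply, oddColumn_apply, oddRow_apply, Matrix.of_apply,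
    Matrix.cons_val, hplus, hminus, hzero, hhalf, hblock, map_zero, zero_smul, one_smul, add_zero,
    hrow, hcorner]
  simp [vecOp_apply, covecOp_apply, coordOp, derivOp]
  rfl

lemma span_splGens (i : Fin 2) (ν : A) :
    Submodule.span ℂ (splGens i ν : Set (MatOp A)) =
      LinearMap.range (glSuper i ν ∘ₗ spl21.carrier.subtype) := by
  rw [LinearMap.range_comp, Submodule.range_subtype]
  have himage : Submodule.span ℂ (splGens i ν : Set (MatOp A)) =
      Submodule.span ℂ (glSuper i ν '' spl21Gens) := congrArg _ (image_spl21Gens i ν).symm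
  exact himage.trans <| (Submodule.map_span _ _).symm.trans <| congrArg _ span_spl21Gens

end Generators

section Qbar

variable {A : Type} [CommRing A]

lemma qbar_self (i : Fin 2) (ν : A) (Δ : ℕ) : qbar i ν Δ Δ = opD A i ^ Δ := by simp [qbar]

lemma qbar_zero_zero (i : Fin 2) (ν : A) : qbar i ν 0 0 = 1 := by rw [qbar_self, pow_zero]

lemma qbar_one_zero (i : Fin 2) (ν : A) : qbar i ν 1 0 = opX A i * opD A i - opC ν := by
  simp [qbar, opC]

lemma qbar_one_one (i : Fin 2) (ν : A) : qbar i ν 1 1 = opD A i := by rw [qbar_self, pow_one]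

lemma gensQ_zero_zero (ν μ : A) : gensQ 0 0 ν μ = {opDown 1, opUp 1} := by
  ext Q
  simp [gensQ, qbar_zero_zero]

lemma gensQ_one_zero (ν μ : A) : gensQ 1 0 ν μ = {opDown 1, opDown (opX A 0),
    opUp (opX A 0 * opD A 0 - opC ν), opUp (opD A 0)} := by
  ext Q
  simp [gensQ, Nat.le_one_iff_eq_zero_or_eq_one, or_and_right, exists_or, qbar_zero_zero,
    qbar_one_zero, qbar_one_one]
  tauto

lemma gensQ_zero_one (ν μ : A) : gensQ 0 1 ν μ = {opDown (opX A 1 * opD A 1 - opC μ),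
    opDown (opD A 1), opUp 1, opUp (opX A 1)} := by
  ext Q
  simp [gensQ, Nat.le_one_iff_eq_zero_or_eq_one, or_and_right, exists_or, qbar_zero_zero,
    qbar_one_zero, qbar_one_one]
  tauto

end Qbar

section Isomorphisms

variable {A : Type} [CommRing A] [Algebra ℂ A]

lemma gens_one_zero (ν μ : A) :
    gensST 1 0 ν μ ∪ {genJ 1 ν} ∪ gensQ 1 0 ν μ = splGens 0 ν ∪ slGens 1 μ := by
  have hblock (P Q R S : PolyOp A) : opBlock 0 P Q R S = !![S, R; Q, P] := rfl
  simp only [gensST, genJ, gensQ_one_zero, splGens, slGens, hblock, opDiag, opUp, opDown,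
    Nat.cast_zero, Nat.cast_one, sub_zero]
  ext Q
  simp only [Set.mem_union, Set.mem_insert_iff, Set.mem_singleton_iff]
  apply iff_of_eq
  ac_rfl

lemma gens_zero_one (ν μ : A) :
    gensST 0 1 ν μ ∪ {genK 1 μ} ∪ gensQ 0 1 ν μ = splGens 1 μ ∪ slGens 0 ν := by
  have hblock (P Q R S : PolyOp A) : opBlock 1 P Q R S = !![P, Q; R, S] := rfl
  simp only [gensST, genK, gensQ_zero_one, splGens, slGens, hblock, opDiag, opUp, opDown,
    Nat.cast_zero, Nat.cast_one, sub_zero]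
  ext Q
  simp only [Set.mem_union, Set.mem_insert_iff, Set.mem_singleton_iff]
  apply iff_of_eq
  ac_rfl

lemma span_splGens_union_slGens (i j : Fin 2) (ν μ : A) :
    Submodule.span ℂ (splGens i ν ∪ slGens j μ : Set (MatOp A)) =
      LinearMap.range (splEmbedding i j ν μ) := by
  rw [splEmbedding, LinearMap.range_coprod, ← span_splGens, ← span_slGens]
  exact Submodule.span_union _ _

lemma superIso_superSpan_splGens_union_slGens [Nontrivial A] {i j : Fin 2} (h : i ≠ j) (ν μ : A) :
    SuperIso (superSpan (L := MatOp A) (splGens i ν ∪ slGens j μ)).carrier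
      (spl21.carrier × SL2) :=
  superIso_superSpan_of_injective (isSuperHom_splEmbedding h ν μ) (splEmbedding_injective h ν μ)
    (span_splGens_union_slGens i j ν μ)

theorem superIso_superS10 [Nontrivial A] (ν μ : A) :
    SuperIso (superS10 ν μ).carrier (spl21.carrier × SL2) := by
  rw [show superS10 ν μ = superSpan _ from congrArg (superSpan (L := MatOp A)) (gens_one_zero ν μ)]
  exact superIso_superSpan_splGens_union_slGens zero_ne_one ν μ

theorem superIso_superS01 [Nontrivial A] (ν μ : A) :
    SuperIso (superS01 ν μ).carrier (spl21.carrier × SL2) := by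
  rw [show superS01 ν μ = superSpan _ from congrArg (superSpan (L := MatOp A)) (gens_zero_one ν μ)]
  exact superIso_superSpan_splGens_union_slGens one_ne_zero μ ν

end Isomorphisms

section FiniteDimensional

variable {A : Type} [CommRing A] [Algebra ℂ A]

instance {ι : Type} [Finite ι] (p : ι → ZMod 2) (E : Type*) [Ring E] [Algebra ℂ E]
    [FiniteDimensional ℂ E] : FiniteDimensional ℂ (SuperMatrix p E) :=
  inferInstanceAs (FiniteDimensional ℂ (Matrix ι ι E))

lemma finiteDimensional_superSpan_insert_opDiag_opC {S : Set (MatOp A)} (c : A)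
    (hS : FiniteDimensional ℂ (superSpan S).carrier) :
    FiniteDimensional ℂ (superSpan (insert (opDiag (opC c) (opC c) : MatOp A) S)).carrier :=
  finiteDimensional_superSpan_insert hS (opDiag_mem_even _ _) fun _ =>
    sbr_opDiag_eq_zero fun _ _ => (commute_opC _ c).symm

lemma genJ_zero (ν : A) : genJ 0 ν = opDiag (opC (half ν)) (opC (half ν)) := by simp [genJ]

lemma genK_zero (μ : A) : genK 0 μ = opDiag (opC (half μ)) (opC (half μ)) := by simp [genK]

lemma finiteDimensional_superS_one_zero [Nontrivial A] (ν μ : A) :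
    FiniteDimensional ℂ (superS 1 0 ν μ).carrier := by
  have hgens : gensST 1 0 ν μ ∪ {genJ 1 ν, genK 0 μ} ∪ gensQ 1 0 ν μ =
      insert (opDiag (opC (half μ)) (opC (half μ)))
        (gensST 1 0 ν μ ∪ {genJ 1 ν} ∪ gensQ 1 0 ν μ) := by
    rw [genK_zero, Set.pair_comm, Set.union_insert, Set.insert_union]
  rw [show superS 1 0 ν μ = superSpan _ from congrArg (superSpan (L := MatOp A)) hgens]
  exact finiteDimensional_superSpan_insert_opDiag_opC _ (superIso_superS10 ν μ).finiteDimensional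

lemma finiteDimensional_superS_zero_one [Nontrivial A] (ν μ : A) :
    FiniteDimensional ℂ (superS 0 1 ν μ).carrier := by
  have hgens : gensST 0 1 ν μ ∪ {genJ 0 ν, genK 1 μ} ∪ gensQ 0 1 ν μ =
      insert (opDiag (opC (half ν)) (opC (half ν)))
        (gensST 0 1 ν μ ∪ {genK 1 μ} ∪ gensQ 0 1 ν μ) := by
    rw [genJ_zero, Set.union_insert, Set.insert_union]
  rw [show superS 0 1 ν μ = superSpan _ from congrArg (superSpan (L := MatOp A)) hgens]
  exact finiteDimensional_superSpan_insert_opDiag_opC _ (superIso_superS01 ν μ).finiteDimensional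

end FiniteDimensional

section InfiniteDimensional

open MvPolynomial Finsupp
open scoped Nat

variable {A : Type} [CommRing A]

/-- The constant-coefficient differential operator `∂ₓ^(m 0) ∂_y^(m 1)`. -/
def opDPow (m : Fin 2 →₀ ℕ) : PolyOp A := opD A 0 ^ m 0 * opD A 1 ^ m 1

lemma opDPow_add (m m' : Fin 2 →₀ ℕ) :
    (opDPow (m + m') : PolyOp A) = opDPow m * opDPow m' := by
  simp only [opDPow, Finsupp.add_apply, pow_add]
  exact (((commute_opD_opD 1 0).pow_pow (m 1) (m' 0)).mul_mul_mul_comm _ _).symm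

lemma opD_pow_mul_opX (i : Fin 2) (a : ℕ) :
    opD A i ^ a * opX A i = opX A i * opD A i ^ a + a • opD A i ^ (a - 1) := by
  induction a with
  | zero => simp
  | succ a ih =>
    rw [pow_succ', mul_assoc, ih, mul_add, ← mul_assoc, opD_mul_opX]
    rcases a with - | a
    · simp
    · simp only [Nat.add_sub_cancel, mul_smul_comm, ← pow_succ']
      rw [add_mul, mul_assoc, ← pow_succ', one_mul, add_smul (a + 1) 1, one_smul]
      abel

lemma opDPow_mul_opX (m : Fin 2 →₀ ℕ) (i : Fin 2) :
    opDPow (m + single i 1) * opX A i - opX A i * opDPow (m + single i 1) =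
      (m i + 1) • opDPow m := by
  have hD (a : ℕ) : opD A i ^ (a + 1) * opX A i - opX A i * opD A i ^ (a + 1) =
      (a + 1) • opD A i ^ a := by
    rw [opD_pow_mul_opX, add_sub_cancel_left, Nat.add_sub_cancel]
  have hcomm {j : Fin 2} (h : i ≠ j) (b : ℕ) : opD A j ^ b * opX A i = opX A i * opD A j ^ b :=
    (commute_opX_opD h).symm.pow_left b
  fin_cases i
  · have hm : (opDPow (m + single 0 1) : PolyOp A) = opD A 0 ^ (m 0 + 1) * opD A 1 ^ m 1 := by
      simp [opDPow]
    simp only [Fin.zero_eta] at hD hcomm ⊢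
    rw [hm, mul_assoc, hcomm zero_ne_one, ← mul_assoc, ← mul_assoc, ← sub_mul, hD, smul_mul_assoc,
      opDPow]
  · have hm : (opDPow (m + single 1 1) : PolyOp A) = opD A 0 ^ m 0 * opD A 1 ^ (m 1 + 1) := by
      simp [opDPow]
    simp only [Fin.mk_one] at hD hcomm ⊢
    rw [hm, ← mul_assoc, ← hcomm one_ne_zero, mul_assoc, mul_assoc, ← mul_sub, hD, mul_smul_comm,
      opDPow]

lemma coeff_opD_pow (i : Fin 2) (a : ℕ) (m : Fin 2 →₀ ℕ) (f : MvPolynomial (Fin 2) A) :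
    coeff m ((opD A i ^ a) f) = (m i + 1).ascFactorial a * coeff (m + single i a) f := by
  induction a generalizing f with
  | zero => simp
  | succ a ih =>
    rw [pow_succ, Module.End.mul_apply, ih, opD_apply, coeff_pderiv, add_assoc, ← single_add,
      Nat.ascFactorial_succ]
    simp
    ring

lemma coeff_zero_opDPow (m : Fin 2 →₀ ℕ) (f : MvPolynomial (Fin 2) A) :
    coeff 0 (opDPow m f) = ((m 0)! * (m 1)! : ℕ) * coeff m f := by
  have hm : single 0 (m 0) + single 1 (m 1) = m := by
    ext i; fin_cases i <;> simp
  rw [opDPow, Module.End.mul_apply, coeff_opD_pow, coeff_opD_pow, zero_add, hm]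
  simp [Nat.one_ascFactorial, mul_assoc]

variable [Algebra ℂ A]

lemma linearIndependent_opDPow [Nontrivial A] :
    LinearIndependent ℂ (opDPow : (Fin 2 →₀ ℕ) → PolyOp A) := by
  refine linearIndependent_iff'.2 fun s c hc m hm => ?_
  have hcoeff := congrArg (coeff 0) (LinearMap.congr_fun hc (monomial m (1 : A)))
  have hfactorial : c m • ((((m 0)! * (m 1)! : ℕ) : ℂ) • (1 : A)) = 0 := by
    simpa [coeff_sum, coeff_zero_opDPow, coeff_monomial, hm, Algebra.smul_def] using hcoeff
  rw [smul_smul, smul_eq_zero_iff_left one_ne_zero] at hfactorial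
  exact (mul_eq_zero.1 hfactorial).resolve_right (Nat.cast_ne_zero.2 (by positivity))

lemma not_finiteDimensional_of_opDPow_mem [Nontrivial A] {W : Submodule ℂ (PolyOp A)}
    (hW : ∀ {S T}, S ∈ W → T ∈ W → S * T - T * S ∈ W) {i : Fin 2} {q : Fin 2 →₀ ℕ} (hq : q ≠ 0)
    (hD : opDPow (q + single i 1) ∈ W) (hX : opX A i * opDPow (q + single i 1) ∈ W) :
    ¬ FiniteDimensional ℂ W := by
  have hmem (k : ℕ) : opDPow ((k + 1) • q + single i 1) ∈ W := by
    induction k with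
    | zero => simpa using hD
    | succ k ih =>
      set m := (k + 1) • q
      have hcomm : opDPow (m + single i 1) * (opX A i * opDPow (q + single i 1)) -
          opX A i * opDPow (q + single i 1) * opDPow (m + single i 1) =
          ((m i + 1 : ℕ) : ℂ) • opDPow ((k + 1 + 1) • q + single i 1) := by
        have hexponent : (k + 1 + 1) • q + single i 1 = m + (q + single i 1) := by
          rw [succ_nsmul q (k + 1), add_assoc]
        rw [hexponent, opDPow_add m (q + _), Nat.cast_smul_eq_nsmul, ← smul_mul_assoc,
          ← opDPow_mul_opX, sub_mul, mul_assoc, mul_assoc, mul_assoc, ← opDPow_add, ← opDPow_add,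
          add_comm (q + _)]
      exact (W.smul_mem_iff (Nat.cast_ne_zero.2 (m i).succ_ne_zero)).1 (hcomm ▸ hW ih hX)
  have hinj : Function.Injective fun k : ℕ => (k + 1) • q + single i 1 := fun k l h => by
    obtain ⟨j, hj⟩ := DFunLike.ne_iff.1 hq
    have hkl := DFunLike.congr_fun (add_right_cancel h) j
    exact Nat.succ_injective (Nat.eq_of_mul_eq_mul_right (Nat.pos_of_ne_zero hj) hkl)
  have hli : LinearIndependent ℂ fun k => (⟨_, hmem k⟩ : W) :=
    .of_comp W.subtype (linearIndependent_opDPow.comp _ hinj)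
  intro hfin
  exact not_finite_iff_infinite.2 (inferInstance : Infinite ℕ) hli.finite

lemma superCommutator_apply_self_of_even {M N : Matrix (Fin 2) (Fin 2) (PolyOp A)}
    (hM : M ∈ superHomogeneous parity11 (PolyOp A) 0)
    (hN : N ∈ superHomogeneous parity11 (PolyOp A) 0) (r : Fin 2) :
    superCommutator parity11 M N r r = M r r * N r r - N r r * M r r := by
  rw [superCommutator_of_mem hM hN]
  fin_cases r <;>
    simp [Matrix.mul_apply, superSign, hM 0 1 (by decide), hM 1 0 (by decide)]

lemma superCommutator_opDown_opUp (S T : PolyOp A) :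
    superCommutator parity11 (opDown S) (opUp T) = opDiag (T * S) (S * T) := by
  simpa [opBlock, opDiag, opUp, opDown] using superCommutator_opBlock 1 0 0 S 0 0 T 0 0

/-- The diagonal entries of index `r` of the even elements of `s`. -/
def diagEntries (s : LieSubsuperalgebra (MatOp A)) (r : Fin 2) : Submodule ℂ (PolyOp A) :=
  (s.carrier ⊓ homog 0).map (Matrix.entryLinearMap ℂ (PolyOp A) r r)

lemma mul_sub_mul_mem_diagEntries (s : LieSubsuperalgebra (MatOp A)) (r : Fin 2) {S T : PolyOp A}
    (hS : S ∈ diagEntries s r) (hT : T ∈ diagEntries s r) :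
    S * T - T * S ∈ diagEntries s r := by
  obtain ⟨M, ⟨hM, hM0⟩, rfl⟩ := hS
  obtain ⟨N, ⟨hN, hN0⟩, rfl⟩ := hT
  refine ⟨_, ⟨s.sbr_closed hM hN, ?_⟩, superCommutator_apply_self_of_even hM0 hN0 r⟩
  exact superCommutator_mem hM0 hN0

lemma mul_mem_diagEntries_of_opDown_opUp {s : LieSubsuperalgebra (MatOp A)} {S T : PolyOp A}
    (hS : (opDown S : MatOp A) ∈ s.carrier) (hT : (opUp T : MatOp A) ∈ s.carrier) :
    T * S ∈ diagEntries s 0 ∧ S * T ∈ diagEntries s 1 := by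
  have hmem : (opDiag (T * S) (S * T) : MatOp A) ∈ s.carrier :=
    superCommutator_opDown_opUp S T ▸ s.sbr_closed hS hT
  exact ⟨⟨_, ⟨hmem, opDiag_mem_even _ _⟩, rfl⟩, ⟨_, ⟨hmem, opDiag_mem_even _ _⟩, rfl⟩⟩

lemma finiteDimensional_diagEntries {s : LieSubsuperalgebra (MatOp A)}
    (hs : FiniteDimensional ℂ s.carrier) (r : Fin 2) : FiniteDimensional ℂ (diagEntries s r) := by
  have : FiniteDimensional ℂ (s.carrier ⊓ homog 0 : Submodule ℂ (MatOp A)) :=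
    Submodule.finiteDimensional_inf_left _ _
  exact Module.Finite.map (s.carrier ⊓ homog 0 : Submodule ℂ (MatOp A))
    (Matrix.entryLinearMap ℂ (PolyOp A) r r)

lemma not_finiteDimensional_superS [Nontrivial A] {Δ Γ : ℕ} (ν μ : A) (h : 2 ≤ Δ + Γ) :
    ¬ FiniteDimensional ℂ (superS Δ Γ ν μ).carrier := by
  intro hfin
  have hQ {Q} (hQ : Q ∈ gensQ Δ Γ ν μ) : (Q : MatOp A) ∈ (superS Δ Γ ν μ).carrier :=
    subset_superSpan (L := MatOp A) _ (Or.inr hQ)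
  have hdown {α : ℕ} (hα : α ≤ Δ) :
      (opDown (opX A 0 ^ α * opD A 1 ^ Γ) : MatOp A) ∈ (superS Δ Γ ν μ).carrier :=
    hQ ⟨α, Γ, hα, le_rfl, Or.inl (by rw [qbar_self])⟩
  have hup {β : ℕ} (hβ : β ≤ Γ) :
      (opUp (opD A 0 ^ Δ * opX A 1 ^ β) : MatOp A) ∈ (superS Δ Γ ν μ).carrier :=
    hQ ⟨Δ, β, le_rfl, hβ, Or.inr (by rw [qbar_self])⟩
  obtain ⟨hD₀, hD₁⟩ := mul_mem_diagEntries_of_opDown_opUp (hdown Δ.zero_le) (hup Γ.zero_le)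
  have hD : (opD A 1 ^ Γ * opD A 0 ^ Δ : PolyOp A) = opD A 0 ^ Δ * opD A 1 ^ Γ :=
    (commute_opD_opD 1 0).pow_pow Γ Δ
  simp only [pow_zero, one_mul, mul_one, hD] at hD₀ hD₁
  rcases Δ with - | d
  · obtain ⟨e, rfl⟩ : ∃ e, Γ = e + 1 := ⟨Γ - 1, by omega⟩
    have hX := (mul_mem_diagEntries_of_opDown_opUp (hdown le_rfl) (hup (Nat.le_add_left 1 e))).1
    refine not_finiteDimensional_of_opDPow_mem (mul_sub_mul_mem_diagEntries _ 0) (i := 1)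
      (q := single 1 e) ?_ ?_ ?_ (finiteDimensional_diagEntries hfin 0)
    · simp; omega
    · simpa [opDPow] using hD₀
    · simpa [opDPow] using hX
  · have hX := (mul_mem_diagEntries_of_opDown_opUp (hdown (Nat.le_add_left 1 d)) (hup Γ.zero_le)).2
    simp only [pow_zero, pow_one, mul_one, mul_assoc, hD] at hX
    refine not_finiteDimensional_of_opDPow_mem (mul_sub_mul_mem_diagEntries _ 1) (i := 0)
      (q := single 0 d + single 1 Γ) ?_ ?_ ?_ (finiteDimensional_diagEntries hfin 1)
    · simp; omega
    · simpa [opDPow] using hD₁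
    · simpa [opDPow] using hX

end InfiniteDimensional

section ZeroZero

variable {A : Type} [CommRing A] [Algebra ℂ A]

lemma gensST_zero_zero (ν μ : A) : gensST 0 0 ν μ = slGens 0 ν ∪ slGens 1 μ := by
  simp only [gensST, slGens, Nat.cast_zero, sub_zero, Set.insert_union, Set.singleton_union]

variable (A) in
/-- Complex matrices as matrices of constant operators. -/
def constMatrix : Matrix (Fin 2) (Fin 2) ℂ →ₐ[ℂ] Matrix (Fin 2) (Fin 2) (PolyOp A) :=
  (Algebra.ofId ℂ (PolyOp A)).mapMatrix

lemma constMatrix_apply (a : Matrix (Fin 2) (Fin 2) ℂ) (r s : Fin 2) :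
    constMatrix A a r s = algebraMap ℂ (PolyOp A) (a r s) := rfl

lemma commute_constMatrix (T : PolyOp A) (a : Matrix (Fin 2) (Fin 2) ℂ) (r s : Fin 2) :
    Commute T (constMatrix A a r s) :=
  (Algebra.commutes (a r s) T).symm

lemma commute_slDiag {i j : Fin 2} (h : i ≠ j) (ν μ : A) (a b : SL2) (r s : Fin 2) :
    Commute (glTwo i ν a.1) (slDiag j μ b r s) := by
  have hcomm := commute_glTwo_glTwo h ν μ a.1 b.1
  fin_cases r <;> fin_cases s
  exacts [hcomm, Commute.zero_right _, Commute.zero_right _, hcomm]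

lemma superCommutator_constMatrix (a b : Matrix (Fin 2) (Fin 2) ℂ) :
    superCommutator parity11 (constMatrix A a) (constMatrix A b) =
      constMatrix A (superCommutator parity11 a b) := by
  ext1 r s
  simp only [superCommutator_apply, constMatrix_apply, map_sum, map_sub, map_mul,
    Algebra.smul_def, Algebra.algebraMap_self, RingHom.id_apply]

variable (A) in
/-- The action of `gl(1|1)` by constant operators. -/
def constSuper : SuperMatrix parity11 ℂ →ₗ[ℂ] MatOp A := (constMatrix A).toLinearMap

lemma isSuperHom_constSuper : IsSuperHom (constSuper A) where
  map_sbr a b := (superCommutator_constMatrix a b).symm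
  map_homog := by
    intro k (a : Matrix (Fin 2) (Fin 2) ℂ) ha r s h
    exact (congrArg (algebraMap ℂ (PolyOp A)) (ha r s h)).trans (map_zero _)

/-- The action of `gl(1|1) ⊕ sl₂ ⊕ sl₂`, by constant operators and on functions of degree `ν` in `x`
and of degree `μ` in `y`. -/
def zeroZeroEmbedding (ν μ : A) : (SuperMatrix parity11 ℂ × SL2) × SL2 →ₗ[ℂ] MatOp A :=
  ((constSuper A).coprod (slDiag 0 ν)).coprod (slDiag 1 μ)

lemma isSuperHom_zeroZeroEmbedding (ν μ : A) : IsSuperHom (zeroZeroEmbedding ν μ) := by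
  refine (isSuperHom_constSuper.coprod (isSuperHom_slDiag 0 ν) (slDiag_mem_even 0 ν) fun a b =>
    sbr_opDiag_eq_zero (commute_constMatrix _ a)).coprod (isSuperHom_slDiag 1 μ)
    (slDiag_mem_even 1 μ) ?_
  rintro ⟨a, b⟩ c
  have hconst : sbr (slDiag 1 μ c) (constSuper A a) = 0 :=
    sbr_opDiag_eq_zero (commute_constMatrix _ a)
  have hslDiag : sbr (slDiag 1 μ c) (slDiag 0 ν b) = 0 :=
    sbr_opDiag_eq_zero (commute_slDiag one_ne_zero μ ν c b)
  rw [LinearMap.coprod_apply, map_add, hconst, hslDiag, add_zero]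

lemma mem_range_slDiag_of_mem_slGens {j : Fin 2} {μ : A} {T : Matrix (Fin 2) (Fin 2) (PolyOp A)}
    (hT : T ∈ slGens j μ) : (T : MatOp A) ∈ LinearMap.range (slDiag j μ) :=
  (span_slGens j μ).le (Submodule.subset_span (R := ℂ) (M := MatOp A) hT)

lemma gensQ_zero_zero_subset_range (ν μ : A) :
    gensQ 0 0 ν μ ⊆ Set.range (constMatrix A) := by
  rw [gensQ_zero_zero]
  rintro _ (rfl | rfl)
  · exact ⟨!![0, 0; 1, 0], by ext1 r s; fin_cases r <;> fin_cases s <;>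
      simp [constMatrix_apply, opDown]⟩
  · exact ⟨!![0, 1; 0, 0], by ext1 r s; fin_cases r <;> fin_cases s <;>
      simp [constMatrix_apply, opUp]⟩

lemma mem_range_zeroZeroEmbedding {ν μ : A} {Q : Matrix (Fin 2) (Fin 2) (PolyOp A)}
    (hQ : Q ∈ gensST 0 0 ν μ ∪ gensQ 0 0 ν μ) :
    (Q : MatOp A) ∈ LinearMap.range (zeroZeroEmbedding ν μ) := by
  rw [gensST_zero_zero] at hQ
  rcases hQ with (hQ | hQ) | hQ
  · obtain ⟨a, rfl⟩ := mem_range_slDiag_of_mem_slGens hQ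
    exact ⟨((0, a), 0), by simp [zeroZeroEmbedding]⟩
  · obtain ⟨b, rfl⟩ := mem_range_slDiag_of_mem_slGens hQ
    exact ⟨((0, 0), b), by simp [zeroZeroEmbedding]⟩
  · obtain ⟨c, rfl⟩ := gensQ_zero_zero_subset_range ν μ hQ
    exact ⟨((c, 0), 0), by simp [zeroZeroEmbedding]; rfl⟩

lemma finiteDimensional_superS_zero_zero (ν μ : A) :
    FiniteDimensional ℂ (superS 0 0 ν μ).carrier := by
  have hgens : gensST 0 0 ν μ ∪ {genJ 0 ν, genK 0 μ} ∪ gensQ 0 0 ν μ =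
      insert (opDiag (opC (half ν)) (opC (half ν)))
        (insert (opDiag (opC (half μ)) (opC (half μ))) (gensST 0 0 ν μ ∪ gensQ 0 0 ν μ)) := by
    rw [genJ_zero, genK_zero, Set.union_insert, Set.union_singleton, Set.insert_union,
      Set.insert_union]
  have hle := superSpan_le (s := (isSuperHom_zeroZeroEmbedding ν μ).range)
    fun _ => mem_range_zeroZeroEmbedding
  have hrange : FiniteDimensional ℂ (isSuperHom_zeroZeroEmbedding ν μ).range.carrier :=
    LinearMap.finiteDimensional_range (zeroZeroEmbedding ν μ)
  rw [show superS 0 0 ν μ = superSpan _ from congrArg (superSpan (L := MatOp A)) hgens]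
  exact finiteDimensional_superSpan_insert_opDiag_opC _ <|
    finiteDimensional_superSpan_insert_opDiag_opC _ <| Submodule.finiteDimensional_of_le hle

end ZeroZero

section LieAlgebra

variable {R L M N : Type*} [CommRing R] [LieRing L] [LieAlgebra R L] [LieRing M] [LieAlgebra R M]
  [LieRing N] [LieAlgebra R N]

/-- The sum of two homomorphisms of Lie algebras with commuting images. -/
def lieCoprod (f : L →ₗ⁅R⁆ N) (g : M →ₗ⁅R⁆ N)
    (hfg : ∀ a b, ⁅f a, g b⁆ = 0) : L × M →ₗ⁅R⁆ N where
  toLinearMap := f.toLinearMap.coprod g.toLinearMap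
  map_lie' := by
    rintro ⟨a, b⟩ ⟨a', b'⟩
    simp [hfg, ← lie_skew (g b) (f a')]

lemma lieCoprod_apply {f : L →ₗ⁅R⁆ N} {g : M →ₗ⁅R⁆ N} (hfg : ∀ a b, ⁅f a, g b⁆ = 0) (t : L × M) :
    lieCoprod f g hfg t = f t.1 + g t.2 := rfl

lemma range_lieCoprod {f : L →ₗ⁅R⁆ N} {g : M →ₗ⁅R⁆ N}
    (hfg : ∀ a b, ⁅f a, g b⁆ = 0) : (lieCoprod f g hfg).range.toSubmodule =
      f.range.toSubmodule ⊔ g.range.toSubmodule :=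
  LinearMap.range_coprod _ _

lemma lieSpan_eq_range_of_span_eq (f : L →ₗ⁅R⁆ M) {S : Set M}
    (hS : Submodule.span R S = f.range.toSubmodule) : LieSubalgebra.lieSpan R M S = f.range :=
  le_antisymm (LieSubalgebra.lieSpan_le.2 (Submodule.span_le.1 hS.le)) fun _ hx =>
    LieSubalgebra.submodule_span_le_lieSpan (hS ▸ hx)

end LieAlgebra

section LieCase

attribute [local instance] LieRing.ofAssociativeRing

variable {A : Type} [CommRing A]

lemma lie_opDiag_self_eq_zero {T : PolyOp A} {M : Matrix (Fin 2) (Fin 2) (PolyOp A)}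
    (h : ∀ r s, Commute T (M r s)) : ⁅opDiag T T, M⁆ = 0 := by
  ext1 r s
  have hrs := sub_eq_zero.2 (h r s).eq
  fin_cases r <;> fin_cases s <;>
    simpa [opDiag, Ring.lie_def, Matrix.mul_apply, -Matrix.cons_mul] using hrs

variable [Algebra ℂ A]

/-- `slDiag` as a homomorphism for the ordinary commutator. -/
def slDiagHom (j : Fin 2) (μ : A) : SL2 →ₗ⁅ℂ⁆ Matrix (Fin 2) (Fin 2) (PolyOp A) where
  toFun := slDiag j μ
  map_add' := map_add (slDiag j μ)
  map_smul' := map_smul (slDiag j μ)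
  map_lie' := by
    intro a b
    simp [slDiag_apply, opDiag, Ring.lie_def, ← glTwo_mul_sub]

variable (A) in
/-- The action of `sl₂` by constant operators. -/
def slConst : SL2 →ₗ⁅ℂ⁆ Matrix (Fin 2) (Fin 2) (PolyOp A) :=
  (constMatrix A).toLieHom.comp (LieAlgebra.SpecialLinear.sl (Fin 2) ℂ).incl

lemma lie_slDiagHom_slDiagHom {i j : Fin 2} (h : i ≠ j) (ν μ : A) (a b : SL2) :
    ⁅slDiagHom i ν a, slDiagHom j μ b⁆ = 0 :=
  lie_opDiag_self_eq_zero (commute_slDiag h ν μ a b)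

lemma lie_slDiagHom_slConst (j : Fin 2) (μ : A) (b c : SL2) :
    ⁅slDiagHom j μ b, slConst A c⁆ = 0 :=
  lie_opDiag_self_eq_zero (commute_constMatrix _ c.1)

/-- The action of `sl₂ ⊕ sl₂ ⊕ sl₂` on functions of degree `ν` in `x` and of degree `μ` in `y`, and
by constant operators. -/
def slCubed (ν μ : A) : SL2 × SL2 × SL2 →ₗ⁅ℂ⁆ Matrix (Fin 2) (Fin 2) (PolyOp A) :=
  lieCoprod (slDiagHom 0 ν)
    (lieCoprod (slDiagHom 1 μ) (slConst A) (lie_slDiagHom_slConst 1 μ)) fun a b => by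
      rw [lieCoprod_apply, lie_add, lie_slDiagHom_slDiagHom zero_ne_one, lie_slDiagHom_slConst,
        add_zero]

lemma slCubed_apply (ν μ : A) (a b c : SL2) : slCubed ν μ (a, b, c) =
    opDiag (glTwo 0 ν a.1) (glTwo 0 ν a.1) +
      (opDiag (glTwo 1 μ b.1) (glTwo 1 μ b.1) + constMatrix A c.1) := rfl

lemma slCubed_injective [Nontrivial A] (ν μ : A) : Function.Injective (slCubed ν μ) := by
  refine (injective_iff_map_eq_zero (slCubed ν μ)).2 ?_
  rintro ⟨a, b, c⟩ habc
  have hentry (r s : Fin 2) := congrFun₂ ((slCubed_apply ν μ a b c).symm.trans habc) r s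
  have h00 : glTwo 0 ν a.1 + (glTwo 1 μ b.1 + algebraMap ℂ (PolyOp A) (c.1 0 0)) = 0 := hentry 0 0
  have h11 : glTwo 0 ν a.1 + (glTwo 1 μ b.1 + algebraMap ℂ (PolyOp A) (c.1 1 1)) = 0 := hentry 1 1
  have h01 : c.1 0 1 = 0 := by simpa [opDiag, constMatrix_apply] using hentry 0 1
  have h10 : c.1 1 0 = 0 := by simpa [opDiag, constMatrix_apply] using hentry 1 0
  have hdiag : c.1 0 0 = c.1 1 1 := (algebraMap ℂ (PolyOp A)).injective <|
    add_left_cancel (add_left_cancel (h00.trans h11.symm))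
  have htrace : c.1 0 0 + c.1 1 1 = 0 := mem_sl_two.1 c.2
  have hc00 : c.1 0 0 = 0 := by linear_combination (1 / 2) * (hdiag + htrace)
  have hc : c = 0 := Subtype.ext <| by
    ext r s
    fin_cases r <;> fin_cases s
    exacts [hc00, h01, h10, hdiag.symm.trans hc00]
  rw [hc00, map_zero, add_zero] at h00
  have ha : a = 0 := SL2.eq_zero_of_commute_glTwo_opX (i := 0) (ν := ν) <| by
    rw [eq_neg_of_add_eq_zero_left h00]
    exact (commute_glTwo (commute_opX_opX 0 1) (commute_opX_opD zero_ne_one) μ b.1).symm.neg_left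
  have hb : b = 0 := SL2.eq_zero_of_commute_glTwo_opX (i := 1) (ν := μ) <| by
    rw [eq_neg_of_add_eq_zero_right h00]
    exact (commute_glTwo (commute_opX_opX 1 0) (commute_opX_opD one_ne_zero) ν a.1).symm.neg_left
  rw [ha, hb, hc]
  rfl

lemma slConst_eq_sum (c : SL2) :
    slConst A c = c.1 0 0 • opDiag 1 (-1) + c.1 1 0 • opDown 1 + c.1 0 1 • opUp 1 := by
  have htrace : c.1 1 1 = -c.1 0 0 := eq_neg_of_add_eq_zero_right (mem_sl_two.1 c.2)
  ext1 r s
  change algebraMap ℂ (PolyOp A) (c.1 r s) = _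
  fin_cases r <;> fin_cases s <;>
    simp [opDiag, opDown, opUp, Algebra.algebraMap_eq_smul_one, htrace]

lemma span_gensQ_zero_zero (ν μ : A) :
    Submodule.span ℂ (insert (opDiag 1 (-1)) (gensQ 0 0 ν μ)) = (slConst A).range.toSubmodule := by
  ext T
  rw [gensQ_zero_zero, Submodule.mem_span_triple]
  constructor
  · rintro ⟨p, q, r, rfl⟩
    exact ⟨⟨!![p, r; q, -p], by simp [mem_sl_two]⟩, slConst_eq_sum _⟩
  · rintro ⟨c, rfl⟩
    exact ⟨c.1 0 0, c.1 1 0, c.1 0 1, (slConst_eq_sum c).symm⟩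

theorem nonempty_lieS00_equiv [Nontrivial A] (ν μ : A) :
    Nonempty (lieS00 ν μ ≃ₗ⁅ℂ⁆ SL2 × SL2 × SL2) := by
  have hspan : Submodule.span ℂ (gensST 0 0 ν μ ∪ {opDiag 1 (-1)} ∪ gensQ 0 0 ν μ) =
      (slCubed ν μ).range.toSubmodule := by
    rw [slCubed, range_lieCoprod, range_lieCoprod, ← span_gensQ_zero_zero ν μ, gensST_zero_zero,
      Set.union_assoc, Set.singleton_union, Submodule.span_union, Submodule.span_union, sup_assoc]
    exact congrArg₂ (· ⊔ ·) (span_slGens 0 ν) (congrArg₂ (· ⊔ ·) (span_slGens 1 μ) rfl)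
  rw [lieS00, lieSpan_eq_range_of_span_eq _ hspan]
  exact ⟨(LieEquiv.ofInjective _ (slCubed_injective ν μ)).symm⟩

end LieCase

section Main

variable {A : Type} [CommRing A] [Algebra ℂ A] [Nontrivial A]

theorem finiteDimensional_superS_iff (Δ Γ : ℕ) (ν μ : A) :
    FiniteDimensional ℂ (superS Δ Γ ν μ).carrier ↔ Δ + Γ ≤ 1 := by
  refine ⟨fun h => ?_, fun h => ?_⟩
  · by_contra! hlt
    exact not_finiteDimensional_superS ν μ hlt h
  · obtain ⟨rfl, rfl⟩ | ⟨rfl, rfl⟩ | ⟨rfl, rfl⟩ :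
        (Δ = 0 ∧ Γ = 0) ∨ (Δ = 1 ∧ Γ = 0) ∨ (Δ = 0 ∧ Γ = 1) := by omega
    exacts [finiteDimensional_superS_zero_zero ν μ, finiteDimensional_superS_one_zero ν μ,
      finiteDimensional_superS_zero_one ν μ]

theorem mainTheorem11_general (ν μ : A) :
    (∀ Δ Γ : ℕ, FiniteDimensional ℂ (superS Δ Γ ν μ).carrier ↔ Δ + Γ ≤ 1) ∧
    SuperIso (superS10 ν μ).carrier (spl21.carrier × SL2) ∧
    SuperIso (superS01 ν μ).carrier (spl21.carrier × SL2) ∧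
    Nonempty (lieS00 ν μ ≃ₗ⁅ℂ⁆ SL2 × SL2 × SL2) :=
  ⟨fun Δ Γ => finiteDimensional_superS_iff Δ Γ ν μ, superIso_superS10 ν μ, superIso_superS01 ν μ,
    nonempty_lieS00_equiv ν μ⟩

end Main

end

/-- The parts for `formalN`, `formalM` concern the abstract algebras, in which `n` and `m` are
formal; the parts for natural numbers `n`, `m` concern the concrete realizations. -/
theorem mainTheorem11 :
    (∀ Δ Γ : ℕ,
      (FiniteDimensional ℂ (superS Δ Γ formalN formalM).carrier ↔ Δ + Γ ≤ 1) ∧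
      ∀ n m : ℕ, Δ ≤ n → Γ ≤ m →
        (FiniteDimensional ℂ (superS Δ Γ (n : ℂ) (m : ℂ)).carrier ↔ Δ + Γ ≤ 1)) ∧
    (SuperIso (superS10 formalN formalM).carrier (spl21.carrier × SL2) ∧
      ∀ n m : ℕ, 1 ≤ n →
        SuperIso (superS10 (n : ℂ) (m : ℂ)).carrier (spl21.carrier × SL2)) ∧
    (SuperIso (superS01 formalN formalM).carrier (spl21.carrier × SL2) ∧
      ∀ n m : ℕ, 1 ≤ m →
        SuperIso (superS01 (n : ℂ) (m : ℂ)).carrier (spl21.carrier × SL2)) ∧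
    (Nonempty (lieS00 formalN formalM ≃ₗ⁅ℂ⁆ SL2 × SL2 × SL2) ∧
      ∀ n m : ℕ, Nonempty (lieS00 (n : ℂ) (m : ℂ) ≃ₗ⁅ℂ⁆ SL2 × SL2 × SL2)) := by
  have hformal := mainTheorem11_general formalN formalM
  have hnum (n m : ℕ) := mainTheorem11_general (n : ℂ) (m : ℂ)
  exact ⟨fun Δ Γ => ⟨hformal.1 Δ Γ, fun n m _ _ => (hnum n m).1 Δ Γ⟩,
    ⟨hformal.2.1, fun n m _ => (hnum n m).2.1⟩,
    ⟨hformal.2.2.1, fun n m _ => (hnum n m).2.2.1⟩,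
    hformal.2.2.2, fun n m => (hnum n m).2.2.2⟩
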